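/- Let $V=(V,Y,\mathbf 1,\omega)$ be a vertex operator algebra over $\mathbb C$: $V=\bigoplus_{n\in\mathbb Z}V_n$ with $\dim V_n<\infty$ and $V_n=0$ for $n\ll0$. For a homogeneous $a\in V_n$ write $\mathrm{wt}\,a=n$, and write $a(n)$ for the modes of vertex operators, $Y(a,z)=\sum_{n\in\mathbb Z}a(n)z^{-n-1}$; $L(-1)=\omega(0)$. An admissible $V$-module is a $V$-module $M=\bigoplus_{n\in\mathbb N}M(n)$ with $a(m)M(n)\subseteq M(n+\mathrm{wt}\,a-m-1)$ (where $M(k)=0$ for $k<0$); $M(0)$ is its bottom degree, and $M$ is generated by its bottom degree if the only $V$-submodule of $M$ containing $M(0)$ is $M$. All formulas below are stated for homogeneous $a$ and extended linearly in $a$. Put $a*v=\sum_{j\ge0}\binom{\mathrm{wt}\,a}{j}a(j-1)v$, $v*a=\sum_{j\ge0}\binom{\mathrm{wt}\,a-1}{j}a(j-1)v$, $a\circ v=\sum_{j\ge0}\binom{\mathrm{wt}\,a}{j}a(j-2)v$ and $o(a)=a(\mathrm{wt}\,a-1)$. Let $O(M)=\mathrm{span}\{a\circ v\}$ and $A(M)=M/O(M)$.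 Zhu's algebra is $A(V)=V/O(V)$ with $[a][b]=[a*b]$; $A(M)$ is an $A(V)$-bimodule by $[a].[v]=[a*v]$, $[v].[a]=[v*a]$, and $M(0)$ is a left $A(V)$-module by $[a].w=o(a)w$. The Borcherds Lie algebra is $L(V)=(V\otimes\mathbb C[t,t^{-1}])/\mathrm{im}(L(-1)\otimes1+1\otimes\frac d{dt})$ with $a_{[n]}$ the class of $a\otimes t^n$ and $[a_{[m]},b_{[n]}]=\sum_{j\ge0}\binom mj(a(j)b)_{[m+n-j]}$; $L(V)_0$ is its Lie subalgebra spanned by all $a_{[\mathrm{wt}\,a-1]}$. The map $a_{[\mathrm{wt}\,a-1]}\mapsto[a]$ is a homomorphism from $L(V)_0$ to $A(V)$ with the commutator bracket, and $M(0)$ is an $L(V)_0$-module through it. For admissible $V$-modules $M^1,M^2$ the contracted tensor product $M^1\odot M^2$ is the quotient of $M^1\otimes_{\mathbb C}M^2$ by the span of all $$\sum_{j\ge0}\binom nj a(j-m)v_1\otimes v_2+v_1\otimes\sum_{j\ge0}\binom{-m}j(-1)^{-m-j}a(n+j)v_2$$ with $a\in V$ homogeneous, $n,m\in\mathbb Z$,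 $n-m<\mathrm{wt}\,a-1$, $v_i\in M^i$. The class of $v_1\otimes v_2$ is denoted by $v_1\odot v_2$. It is an $L(V)_0$-module by $$a_{[\mathrm{wt}\,a-1]}.(v_1\odot v_2)=\sum_{j\ge0}\binom{\mathrm{wt}\,a-1}j a(j)v_1\odot v_2+v_1\odot o(a)v_2.$$ **Theorem A.** Let $M^1$ and $M^2$ be admissible $V$-modules. (1) If $M^1$ or $M^2$ is generated by its bottom degree, then the $L(V)_0$-module $M^1\odot M^2$ is a left $A(V)$-module by $$[a].(v_1\odot v_2)=(a*v_1-v_1*a)\odot v_2+v_1\odot o(a)v_2,\qquad a\in V,\ v_1\in M^1,\ v_2\in M^2,$$ and its $L(V)_0$-action is the pull-back of this action along $L(V)_0\to A(V)$, $a_{[\mathrm{wt}\,a-1]}\mapsto[a]$. (2) If $M^2$ is generated by $M^2(0)$, then there is an epimorphism of left $A(V)$-modules $$\pi:A(M^1)\otimes_{A(V)}M^2(0)\to M^1\odot M^2,\qquad \pi([v_1]\otimes v^2)=v_1\odot v^2.$$ (3) If $M^2$ is generated by $M^2(0)$, then for every admissible $V$-module $M^3$ $$\dim\mathrm{Hom}_{L(V)_0}(M^1\odot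 M^2,M^3(0))\le\dim\mathrm{Hom}_{A(V)}\bigl(A(M^1)\otimes_{A(V)}M^2(0),M^3(0)\bigr),$$ where dimensions over $\mathbb C$ are cardinal numbers. -/

import Mathlib

open scoped TensorProduct

noncomputable section

namespace VOATheory

/-- A vertex operator algebra over `ℂ`.  `Y a n` is the mode `a(n)` of the vertex operator
`Y(a,z) = ∑ₙ a(n) z^(-n-1)`, `grade n` is the weight space `V_n`, `vac` is the vacuum element and
`conf` the Virasoro element `ω`, so that `L(n) = ω(n+1)`.  The Jacobi identity (equivalently, weak
commutativity and weak associativity) is stated in its component form, the Borcherds identity; all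
the sums there are finite by the truncation property. -/
class VOA (V : Type*) [AddCommGroup V] [Module ℂ V] where
  Y : V →ₗ[ℂ] (ℤ → Module.End ℂ V)
  grade : ℤ → Submodule ℂ V
  vac : V
  conf : V
  charge : ℂ
  isInternal : DirectSum.IsInternal grade
  finiteDimensional_grade : ∀ n, FiniteDimensional ℂ (grade n)
  grade_eq_bot : ∃ N : ℤ, ∀ n < N, grade n = ⊥
  vac_mem : vac ∈ grade 0
  conf_mem : conf ∈ grade 2
  truncation : ∀ a b : V, ∃ N : ℤ, ∀ n ≥ N, Y a n b = 0
  vacuum : ∀ n : ℤ, Y vac n = if n = -1 then LinearMap.id else 0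
  creation : ∀ a : V, Y a (-1) vac = a
  creation_of_nonneg : ∀ (a : V) (n : ℤ), 0 ≤ n → Y a n vac = 0
  borcherds : ∀ (a b c : V) (l m n : ℤ),
    (∑ᶠ i : ℕ, ((-1) ^ i * Ring.choose l i : ℤ) • Y a (m + l - i) (Y b (n + i) c))
      - (∑ᶠ i : ℕ, ((-1) ^ i * (l.negOnePow : ℤ) * Ring.choose l i : ℤ) •
          Y b (n + l - i) (Y a (m + i) c))
      = ∑ᶠ i : ℕ, (Ring.choose m i : ℤ) • Y (Y a (l + i) b) (m + n - i) c
  virasoro : ∀ m n : ℤ,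
    Y conf (m + 1) * Y conf (n + 1) - Y conf (n + 1) * Y conf (m + 1)
      = ((m : ℂ) - n) • Y conf (m + n + 1)
        + if m + n = 0 then (((m : ℂ) ^ 3 - m) / 12 * charge) • (1 : Module.End ℂ V) else 0
  derivative : ∀ (a : V) (n : ℤ), Y (Y conf 0 a) n = (-n : ℤ) • Y a (n - 1)
  eigenspace : ∀ (n : ℤ), ∀ a ∈ grade n, Y conf 1 a = (n : ℂ) • a

/-- The vertex operator of a (weak) module over a vertex operator algebra: all the axioms of an
admissible module that do not involve the grading of the module. -/
class WeakModule (V M : Type*) [AddCommGroup V] [Module ℂ V] [VOA V]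
    [AddCommGroup M] [Module ℂ M] where
  Y : V →ₗ[ℂ] (ℤ → Module.End ℂ M)
  truncation : ∀ (a : V) (u : M), ∃ N : ℤ, ∀ n ≥ N, Y a n u = 0
  vacuum : ∀ n : ℤ, Y (VOA.vac : V) n = if n = -1 then LinearMap.id else 0
  borcherds : ∀ (a b : V) (u : M) (l m n : ℤ),
    (∑ᶠ i : ℕ, ((-1) ^ i * Ring.choose l i : ℤ) • Y a (m + l - i) (Y b (n + i) u))
      - (∑ᶠ i : ℕ, ((-1) ^ i * (l.negOnePow : ℤ) * Ring.choose l i : ℤ) •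
          Y b (n + l - i) (Y a (m + i) u))
      = ∑ᶠ i : ℕ, (Ring.choose m i : ℤ) • Y (VOA.Y a (l + i) b) (m + n - i) u
  derivative : ∀ (a : V) (n : ℤ), Y (VOA.Y (VOA.conf : V) 0 a) n = (-n : ℤ) • Y a (n - 1)

/-- An admissible module `M = ⨁_{n ∈ ℕ} M(n)`; `grade n` is `M(n)` (and `M(n) = 0` for `n < 0`). -/
class AdmissibleModule (V M : Type*) [AddCommGroup V] [Module ℂ V] [VOA V]
    [AddCommGroup M] [Module ℂ M] extends WeakModule V M where
  grade : ℕ → Submodule ℂ M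
  isInternal : DirectSum.IsInternal grade
  grading : ∀ (p : ℤ), ∀ a ∈ VOA.grade (V := V) p, ∀ (m : ℤ) (n : ℕ), ∀ u ∈ grade n,
    ∀ k : ℕ, (k : ℤ) = n + p - m - 1 → Y a m u ∈ grade k
  grading_neg : ∀ (p : ℤ), ∀ a ∈ VOA.grade (V := V) p, ∀ (m : ℤ) (n : ℕ), ∀ u ∈ grade n,
    n + p - m - 1 < 0 → Y a m u = 0

instance VOA.instWeakModule (V : Type*) [AddCommGroup V] [Module ℂ V] [VOA V] :
    WeakModule V V where
  Y := VOA.Y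
  truncation := VOA.truncation
  vacuum := VOA.vacuum
  borcherds := VOA.borcherds
  derivative := VOA.derivative

/-! ### Mode sums -/

section Modes

variable {V M : Type*} [AddCommGroup V] [Module ℂ V] [VOA V]
  [AddCommGroup M] [Module ℂ M] [WeakModule V M]

local notation "mY" => WeakModule.Y

lemma exists_trunc (a : V) (u : M) (s : ℤ) :
    ∃ N : ℕ, ∀ n : ℤ, s + N ≤ n → mY a n u = 0 := by
  obtain ⟨N, hN⟩ := WeakModule.truncation a u
  refine ⟨(N - s).toNat, fun n hn => hN n ?_⟩
  have := Int.self_le_toNat (N - s)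
  omega

lemma finsum_eq_range {M : Type*} [AddCommGroup M] (f : ℕ → M) (N : ℕ) (h : ∀ j, N ≤ j → f j = 0) :
    ∑ᶠ j, f j = ∑ j ∈ Finset.range N, f j := by
  apply finsum_eq_sum_of_support_subset
  intro j hj
  simp only [Finset.coe_range, Set.mem_Iio]
  by_contra hc
  exact hj (h j (not_lt.1 hc))

/-- `modeSum p s a u = ∑_{j ≥ 0} (p choose j) a(s + j) u`, that is, the residue
`Res_x Y_M(a,x) u · x^s (1+x)^p`, with `(1+x)^p` expanded in nonnegative powers of `x`. -/
def modeSumFun (p s : ℤ) (a : V) (u : M) : M :=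
  ∑ᶠ j : ℕ, (Ring.choose p j : ℤ) • mY a (s + j) u

lemma modeSumFun_eq (p s : ℤ) (a : V) (u : M) (N : ℕ)
    (h : ∀ n : ℤ, s + N ≤ n → mY a n u = 0) :
    modeSumFun p s a u = ∑ j ∈ Finset.range N, (Ring.choose p j : ℤ) • mY a (s + j) u := by
  apply finsum_eq_range
  intro j hj
  rw [h _ (by omega), smul_zero]

/-- The bilinear map `(a, u) ↦ ∑_{j ≥ 0} (p choose j) a(s + j) u`. -/
def modeSum (p s : ℤ) : V →ₗ[ℂ] M →ₗ[ℂ] M :=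
  LinearMap.mk₂ ℂ (fun a u => ∑ᶠ j : ℕ, (Ring.choose p j : ℤ) • mY a (s + j) u)
    (fun a a' u => by
      obtain ⟨N, hN⟩ := exists_trunc a u s
      obtain ⟨N', hN'⟩ := exists_trunc a' u s
      change modeSumFun p s _ _ = modeSumFun p s _ _ + modeSumFun p s _ _
      rw [modeSumFun_eq p s a u (max N N') (fun n hn => hN n (by push_cast at hn; omega)),
        modeSumFun_eq p s a' u (max N N') (fun n hn => hN' n (by push_cast at hn; omega)),
        modeSumFun_eq p s (a + a') u (max N N') (fun n hn => by
          rw [map_add, Pi.add_apply, LinearMap.add_apply, hN n (by push_cast at hn; omega),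
            hN' n (by push_cast at hn; omega), add_zero]), ← Finset.sum_add_distrib]
      simp)
    (fun c a u => by
      obtain ⟨N, hN⟩ := exists_trunc a u s
      change modeSumFun p s _ _ = c • modeSumFun p s _ _
      rw [modeSumFun_eq p s a u N hN, modeSumFun_eq p s (c • a) u N (fun n hn => by
          rw [map_smul, Pi.smul_apply, LinearMap.smul_apply, hN n hn, smul_zero]),
        Finset.smul_sum]
      exact Finset.sum_congr rfl fun j _ => by
        rw [map_smul, Pi.smul_apply, LinearMap.smul_apply, smul_comm])
    (fun a u u' => by
      obtain ⟨N, hN⟩ := exists_trunc a u s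
      obtain ⟨N', hN'⟩ := exists_trunc a u' s
      change modeSumFun p s _ _ = modeSumFun p s _ _ + modeSumFun p s _ _
      rw [modeSumFun_eq p s a u (max N N') (fun n hn => hN n (by push_cast at hn; omega)),
        modeSumFun_eq p s a u' (max N N') (fun n hn => hN' n (by push_cast at hn; omega)),
        modeSumFun_eq p s a (u + u') (max N N') (fun n hn => by
          rw [map_add, hN n (by push_cast at hn; omega),
            hN' n (by push_cast at hn; omega), add_zero]), ← Finset.sum_add_distrib]
      simp)
    (fun c a u => by
      obtain ⟨N, hN⟩ := exists_trunc a u s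
      change modeSumFun p s _ _ = c • modeSumFun p s _ _
      rw [modeSumFun_eq p s a u N hN, modeSumFun_eq p s a (c • u) N (fun n hn => by
          rw [map_smul, hN n hn, smul_zero]),
        Finset.smul_sum]
      exact Finset.sum_congr rfl fun j _ => by rw [map_smul, smul_comm])

lemma modeSum_eq (p s : ℤ) (a : V) (u : M) (N : ℕ)
    (h : ∀ n : ℤ, s + N ≤ n → mY a n u = 0) :
    modeSum p s a u = ∑ j ∈ Finset.range N, (Ring.choose p j : ℤ) • mY a (s + j) u :=
  modeSumFun_eq p s a u N h

lemma modeSum_eq_zero (p s : ℤ) (a : V) (u : M)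
    (h : ∀ n : ℤ, s ≤ n → mY a n u = 0) : modeSum p s a u = 0 := by
  rw [modeSum_eq p s a u 0 (fun n hn => h n (by simpa using hn))]; simp

lemma modeSum_zero (s : ℤ) (a : V) (u : M) : modeSum 0 s a u = mY a s u := by
  obtain ⟨N, hN⟩ := exists_trunc a u s
  rw [modeSum_eq 0 s a u (N + 1) (fun n hn => hN n (by push_cast at hn; omega)),
    Finset.sum_range_succ', Finset.sum_eq_zero]
  · simp
  · intro i _; rw [Ring.choose_zero_succ, zero_smul]

/-- Pascal's rule. -/
lemma modeSum_succ (p s : ℤ) (a : V) (u : M) :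
    modeSum (p + 1) s a u = modeSum p s a u + modeSum p (s + 1) a u := by
  obtain ⟨N, hN⟩ := exists_trunc a u s
  rw [modeSum_eq (p + 1) s a u (N + 1) (fun n hn => hN n (by push_cast at hn; omega)),
    modeSum_eq p s a u (N + 1) (fun n hn => hN n (by push_cast at hn; omega)),
    modeSum_eq p (s + 1) a u N (fun n hn => hN n (by omega)),
    Finset.sum_range_succ' _ N, Finset.sum_range_succ' _ N]
  have : ∀ i : ℕ, (Ring.choose (p + 1) (i + 1) : ℤ) • mY a (s + ((i + 1 : ℕ) : ℤ)) u
      = (Ring.choose p (i + 1) : ℤ) • mY a (s + ((i + 1 : ℕ) : ℤ)) u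
        + (Ring.choose p i : ℤ) • mY a (s + 1 + i) u := by
    intro i
    rw [Ring.choose_succ_succ, add_smul, add_comm]
    congr 3
    push_cast; ring_nf
  simp only [this, Finset.sum_add_distrib, Ring.choose_zero_right]
  abel

lemma choose_succ_mul (p : ℤ) (j : ℕ) :
    ((j : ℤ) + 1) * Ring.choose p (j + 1) = p * Ring.choose (p - 1) j := by
  have := Ring.choose_smul_choose p (n := j + 1) (k := 1) (by omega)
  simpa [mul_comm] using this

/-- Integration by parts. -/
lemma modeSum_derivative (p s : ℤ) (a : V) (u : M) :
    modeSum p s (VOA.Y (VOA.conf : V) 0 a) u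
      = (-s : ℤ) • modeSum p (s - 1) a u - p • modeSum (p - 1) s a u := by
  obtain ⟨N, hN⟩ := exists_trunc a u (s - 1)
  rw [modeSum_eq p s _ u (N + 1) (fun n hn => by
      rw [WeakModule.derivative, LinearMap.smul_apply,
        hN (n - 1) (by push_cast at hn; omega), smul_zero]),
    modeSum_eq p (s - 1) a u (N + 1) (fun n hn => hN n (by push_cast at hn; omega)),
    modeSum_eq (p - 1) s a u N (fun n hn => hN n (by omega))]
  have key : ∀ j : ℕ, (Ring.choose p j : ℤ) • mY (VOA.Y (VOA.conf : V) 0 a) (s + j) u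
      = (-s : ℤ) • (Ring.choose p j : ℤ) • mY a (s - 1 + j) u
        - ((j : ℤ) * Ring.choose p j) • mY a (s - 1 + j) u := by
    intro j
    rw [WeakModule.derivative, LinearMap.smul_apply,
      show s + (j : ℤ) - 1 = s - 1 + j by ring, smul_smul, smul_smul, ← sub_smul]
    congr 1; ring
  simp only [key, Finset.sum_sub_distrib]
  rw [← Finset.smul_sum, Finset.sum_range_succ' (fun j : ℕ =>
    ((j : ℤ) * Ring.choose p j) • mY a (s - 1 + j) u) N]
  simp only [Nat.cast_zero, zero_mul, zero_smul, add_zero]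
  congr 1
  rw [Finset.smul_sum]
  refine Finset.sum_congr rfl fun j _ => ?_
  rw [smul_smul, ← choose_succ_mul]
  congr 2
  push_cast; ring_nf

lemma modeSum_vac (p : ℤ) (u : M) : modeSum p (-1) (VOA.vac : V) u = u := by
  rw [modeSum_eq p (-1) _ u 1 (fun n hn => by
    rw [WeakModule.vacuum, if_neg (by push_cast at hn; omega)]; rfl)]
  simp [WeakModule.vacuum]

lemma borcherds_range (a b : V) (u : M) (l m n : ℤ) (I : ℕ)
    (h1 : ∀ i : ℤ, n + I ≤ i → mY b i u = 0) (h2 : ∀ i : ℤ, m + I ≤ i → mY a i u = 0)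
    (h3 : ∀ i : ℤ, l + I ≤ i → VOA.Y a i b = 0) :
    (∑ i ∈ Finset.range I, ((-1) ^ i * Ring.choose l i : ℤ) • mY a (m + l - i) (mY b (n + i) u))
      - (∑ i ∈ Finset.range I, ((-1) ^ i * (l.negOnePow : ℤ) * Ring.choose l i : ℤ) •
          mY b (n + l - i) (mY a (m + i) u))
      = ∑ i ∈ Finset.range I, (Ring.choose m i : ℤ) • mY (VOA.Y a (l + i) b) (m + n - i) u := by
  have := WeakModule.borcherds a b u l m n
  rwa [finsum_eq_range _ I (fun j hj => by rw [h1 _ (by omega), map_zero, smul_zero]),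
    finsum_eq_range _ I (fun j hj => by rw [h2 _ (by omega), map_zero, smul_zero]),
    finsum_eq_range _ I (fun j hj => by
      rw [h3 _ (by omega), map_zero, Pi.zero_apply, LinearMap.zero_apply, smul_zero])] at this

lemma exists_trunc_range (s : ℤ) (I : ℕ) (a : V) (u : ℕ → M) :
    ∃ N : ℕ, ∀ i < I, ∀ n : ℤ, s + N ≤ n → mY a n (u i) = 0 := by
  choose N hN using fun i => exists_trunc a (u i) s
  refine ⟨(Finset.range I).sup N, fun i hi n hn => hN i n ?_⟩
  have : N i ≤ (Finset.range I).sup N := Finset.le_sup (Finset.mem_range.2 hi)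
  omega

lemma exists_trunc_range' (s : ℤ) (I : ℕ) (a : ℕ → V) (u : M) :
    ∃ N : ℕ, ∀ i < I, ∀ n : ℤ, s + N ≤ n → mY (a i) n u = 0 := by
  choose N hN using fun i => exists_trunc (a i) u s
  refine ⟨(Finset.range I).sup N, fun i hi n hn => hN i n ?_⟩
  have : N i ≤ (Finset.range I).sup N := Finset.le_sup (Finset.mem_range.2 hi)
  omega

lemma choose_antidiagonal (p q : ℤ) (i n : ℕ) :
    ∑ mk ∈ Finset.HasAntidiagonal.antidiagonal n,
        Ring.choose p mk.1 * Ring.choose q mk.2 * Ring.choose (mk.1 : ℤ) i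
      = if i ≤ n then Ring.choose p i * Ring.choose (p + q - i) (n - i) else 0 := by
  have h0 : ∀ m : ℕ, m < i → Ring.choose (m : ℤ) i = 0 := fun m hm => by
    rw [Ring.choose_natCast, Nat.choose_eq_zero_of_lt hm]; rfl
  split_ifs with h
  · obtain ⟨r, rfl⟩ := Nat.exists_eq_add_of_le h
    rw [show p + q - (i : ℤ) = (p - i) + q by ring, Nat.add_sub_cancel_left,
      Ring.add_choose_eq r (Commute.all (p - (i : ℤ)) q), Finset.mul_sum]
    have hinj : Function.Injective (fun x : ℕ × ℕ => (x.1 + i, x.2)) := by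
      rintro ⟨a, b⟩ ⟨c, d⟩ h
      simp only [Prod.mk.injEq, add_left_inj] at h
      exact Prod.ext h.1 h.2
    symm
    refine Finset.sum_of_injOn (fun x : ℕ × ℕ => (x.1 + i, x.2)) hinj.injOn ?_ ?_ ?_
    · rintro x hx
      simp only [Finset.mem_coe, Finset.HasAntidiagonal.mem_antidiagonal] at hx ⊢
      omega
    · intro x hx hx'
      rw [h0, mul_zero]
      by_contra hc
      apply hx'
      simp only [Finset.HasAntidiagonal.mem_antidiagonal] at hx
      refine ⟨(x.1 - i, x.2), ?_, Prod.ext (by simp only; omega) rfl⟩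
      simp only [Finset.mem_coe, Finset.HasAntidiagonal.mem_antidiagonal]
      omega
    · intro x _
      have := Ring.choose_smul_choose p (n := x.1 + i) (k := i) (by omega)
      rw [Nat.add_sub_cancel, nsmul_eq_mul] at this
      simp only
      rw [Ring.choose_natCast, ← mul_assoc, ← this]
      ring
  · exact Finset.sum_eq_zero fun x hx => by
      rw [h0 _ (by have := Finset.HasAntidiagonal.mem_antidiagonal.1 hx; omega), mul_zero]

lemma sum_box {M : Type*} [AddCommGroup M] (N : ℕ) (F : ℕ → ℕ → ℤ) (c : ℕ → M) (hc : ∀ n, N ≤ n → c n = 0) :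
    ∑ m ∈ Finset.range N, ∑ k ∈ Finset.range N, F m k • c (m + k)
      = ∑ n ∈ Finset.range N, (∑ mk ∈ Finset.HasAntidiagonal.antidiagonal n, F mk.1 mk.2) • c n := by
  simp only [Finset.sum_smul]
  rw [← Finset.sum_product', Finset.sum_sigma']
  symm
  refine Finset.sum_of_injOn (fun x : (_ : ℕ) × ℕ × ℕ => x.2) ?_ ?_ ?_ ?_
  · rintro ⟨n, m, k⟩ h ⟨n', m', k'⟩ h' h3
    simp only [Finset.coe_sigma, Set.mem_sigma_iff, Finset.mem_coe,
      Finset.HasAntidiagonal.mem_antidiagonal] at h h'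
    simp only [Prod.mk.injEq] at h3
    obtain ⟨rfl, rfl⟩ := h3
    obtain rfl : n = n' := by omega
    rfl
  · rintro ⟨n, m, k⟩ h
    simp only [Finset.coe_sigma, Set.mem_sigma_iff, Finset.mem_coe, Finset.mem_range,
      Finset.HasAntidiagonal.mem_antidiagonal, Finset.coe_product, Set.mem_prod] at h ⊢
    omega
  · rintro ⟨m, k⟩ h h'
    rw [hc, smul_zero]
    by_contra hlt
    apply h'
    exact ⟨⟨m + k, m, k⟩, Finset.mem_coe.2 (Finset.mem_sigma.2
      ⟨Finset.mem_range.2 (not_le.1 hlt), Finset.HasAntidiagonal.mem_antidiagonal.2 rfl⟩), rfl⟩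
  · rintro ⟨n, m, k⟩ h
    simp only [Finset.mem_sigma, Finset.HasAntidiagonal.mem_antidiagonal] at h
    rw [← h.2]

/-- The residue form of the Jacobi identity for the functions `z^m w^t (z - w)^l (1+z)^p (1+w)^q`. -/
lemma modeSum_borcherds (a b : V) (u : M) (p q l t : ℤ) :
    ∃ I : ℕ, 0 < I ∧
    (∑ i ∈ Finset.range I, ((-1) ^ i * Ring.choose l i : ℤ) •
        modeSum p (l - i) a (modeSum q (t + i) b u))
      - (∑ i ∈ Finset.range I, ((-1) ^ i * (l.negOnePow : ℤ) * Ring.choose l i : ℤ) •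
          modeSum q (t + l - i) b (modeSum p i a u))
      = (∑ i ∈ Finset.range I, (Ring.choose p i : ℤ) •
          modeSum (p + q - i) t (VOA.Y a (l + i) b) u) ∧
    (∀ i : ℤ, t + I ≤ i → mY b i u = 0) ∧ (∀ i : ℤ, I ≤ i → mY a i u = 0) ∧
    (∀ i : ℤ, l + I ≤ i → VOA.Y a i b = 0) := by
  obtain ⟨I₁, h₁⟩ := exists_trunc b u t
  obtain ⟨I₂, h₂⟩ := exists_trunc a u 0
  obtain ⟨I₃, h₃⟩ := exists_trunc a b l
  obtain ⟨I, hI₀, hI₁, hI₂, hI₃⟩ : ∃ I, 0 < I ∧ I₁ ≤ I ∧ I₂ ≤ I ∧ I₃ ≤ I :=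
    ⟨max I₁ (max I₂ I₃) + 1, by omega, by omega, by omega, by omega⟩
  have g₁ : ∀ i : ℤ, t + I ≤ i → mY b i u = 0 := fun i hi => h₁ i (by omega)
  have g₂ : ∀ i : ℤ, I ≤ i → mY a i u = 0 := fun i hi => h₂ i (by omega)
  have g₃ : ∀ i : ℤ, l + I ≤ i → VOA.Y a i b = 0 := fun i hi => h₃ i (by omega)
  refine ⟨I, hI₀, ?_, g₁, g₂, g₃⟩
  obtain ⟨N₁, k₁⟩ := exists_trunc_range (l - I) I a (fun j => mY b (t + j) u)
  obtain ⟨N₂, k₂⟩ := exists_trunc_range (t + l - I) I b (fun j => mY a j u)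
  obtain ⟨N₃, k₃⟩ := exists_trunc_range' (t - I) I (fun i => VOA.Y a (l + i) b) u
  obtain ⟨N, hN₀, hN₁, hN₂, hN₃⟩ : ∃ N, I ≤ N ∧ N₁ ≤ N ∧ N₂ ≤ N ∧ N₃ ≤ N :=
    ⟨max I (max N₁ (max N₂ N₃)), by omega, by omega, by omega, by omega⟩
  have e₁ : ∀ i ∈ Finset.range I, modeSum p (l - i) a (modeSum q (t + i) b u)
      = ∑ m ∈ Finset.range N, ∑ k ∈ Finset.range N,
        (Ring.choose p m * Ring.choose q k : ℤ) • mY a (m + l - i) (mY b (t + k + i) u) := by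
    intro i hi
    have hi := Finset.mem_range.1 hi
    rw [modeSum_eq q (t + i) b u N (fun n hn => g₁ n (by omega)), modeSum_eq p _ a _ N]
    · refine Finset.sum_congr rfl fun m _ => ?_
      rw [map_sum, Finset.smul_sum]
      refine Finset.sum_congr rfl fun k _ => ?_
      rw [map_zsmul, smul_smul]
      congr 3
      · ring_nf
      · ring_nf
    · intro n hn
      rw [map_sum]
      refine Finset.sum_eq_zero fun k _ => ?_
      rw [map_zsmul]
      by_cases hk : k + i < I
      · have := k₁ (k + i) hk n (by omega)
        rw [show t + (i : ℤ) + k = t + ((k + i : ℕ) : ℤ) by push_cast; ring, this, smul_zero]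
      · rw [g₁ _ (by omega), map_zero, smul_zero]
  have e₂ : ∀ i ∈ Finset.range I, modeSum q (t + l - i) b (modeSum p i a u)
      = ∑ m ∈ Finset.range N, ∑ k ∈ Finset.range N,
        (Ring.choose p m * Ring.choose q k : ℤ) • mY b (t + k + l - i) (mY a (m + i) u) := by
    intro i hi
    have hi := Finset.mem_range.1 hi
    rw [modeSum_eq p i a u N (fun n hn => g₂ n (by omega)), modeSum_eq q _ b _ N,
      Finset.sum_comm]
    · refine Finset.sum_congr rfl fun m _ => ?_
      rw [map_sum, Finset.smul_sum]
      refine Finset.sum_congr rfl fun k _ => ?_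
      rw [map_zsmul, smul_smul, show t + l - (i : ℤ) + m = t + m + l - i by ring,
        add_comm (i : ℤ) k, mul_comm (Ring.choose q m)]
    · intro n hn
      rw [map_sum]
      refine Finset.sum_eq_zero fun k _ => ?_
      rw [map_zsmul]
      by_cases hk : k + i < I
      · have := k₂ (k + i) hk n (by omega)
        rw [show (i : ℤ) + k = ((k + i : ℕ) : ℤ) by push_cast; ring, this, smul_zero]
      · rw [g₂ _ (by omega), map_zero, smul_zero]
  have e₃ : ∀ i ∈ Finset.range I,
      (Ring.choose p i : ℤ) • modeSum (p + q - i) t (VOA.Y a (l + i) b) u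
      = ∑ m ∈ Finset.range N, ∑ k ∈ Finset.range N,
        (Ring.choose p m * Ring.choose q k * Ring.choose (m : ℤ) i : ℤ) •
          mY (VOA.Y a (l + i) b) (m + (t + k) - i) u := by
    intro i hi
    have hi := Finset.mem_range.1 hi
    have hz : ∀ n : ℤ, t - I + N ≤ n → mY (VOA.Y a (l + i) b) n u = 0 :=
      fun n hn => k₃ i hi n (by omega)
    have hs := sum_box N (fun m k => Ring.choose p m * Ring.choose q k * Ring.choose (m : ℤ) i)
      (fun n => mY (VOA.Y a (l + i) b) (t + n - i) u) (fun n hn => hz _ (by omega))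
    have hl : ∀ m k : ℕ, (m : ℤ) + (t + k) - i = t + ((m + k : ℕ) : ℤ) - i := by
      intro m k; push_cast; ring
    simp only [hl]
    rw [hs]
    simp only [choose_antidiagonal]
    obtain ⟨R, rfl⟩ : ∃ R, N = i + R := ⟨N - i, by omega⟩
    rw [Finset.sum_range_add, Finset.sum_eq_zero, zero_add,
      modeSum_eq _ t _ u R (fun n hn => hz n (by push_cast; omega)), Finset.smul_sum]
    · refine Finset.sum_congr rfl fun r _ => ?_
      rw [if_pos (by omega), smul_smul, Nat.add_sub_cancel_left]
      congr 3
      push_cast; ring_nf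
    · intro n hn
      rw [if_neg (by have := Finset.mem_range.1 hn; omega), zero_smul]
  rw [Finset.sum_congr rfl e₃, Finset.sum_congr rfl fun i hi => congrArg _ (e₁ i hi),
    Finset.sum_congr rfl fun i hi => congrArg _ (e₂ i hi)]
  simp only [Finset.smul_sum]
  rw [Finset.sum_comm, Finset.sum_comm (s := Finset.range I),
    Finset.sum_comm (s := Finset.range I), ← Finset.sum_sub_distrib]
  refine Finset.sum_congr rfl fun m _ => ?_
  rw [Finset.sum_comm, Finset.sum_comm (s := Finset.range I),
    Finset.sum_comm (s := Finset.range I), ← Finset.sum_sub_distrib]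
  refine Finset.sum_congr rfl fun k _ => ?_
  have hB := borcherds_range a b u l m (t + k) I (fun i hi => g₁ i (by omega))
    (fun i hi => g₂ i (by omega)) g₃
  have hB' := congrArg (fun x => (Ring.choose p m * Ring.choose q k : ℤ) • x) hB
  simp only [smul_sub, Finset.smul_sum, smul_smul] at hB' ⊢
  refine Eq.trans ?_ hB'
  congr 1
  · exact Finset.sum_congr rfl fun i _ => by congr 1; ring
  · exact Finset.sum_congr rfl fun i _ => by congr 1; ring

end Modes

section Grading

variable {V : Type*} [AddCommGroup V] [Module ℂ V] [VOA V]
  {W : Type*} [AddCommGroup W] [Module ℂ W]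

lemma homogeneous_induction {P : V → Prop} (h0 : P 0) (hadd : ∀ a b, P a → P b → P (a + b))
    (hP : ∀ (p : ℤ), ∀ a ∈ VOA.grade (V := V) p, P a) (a : V) : P a := by
  have : a ∈ ⨆ p, VOA.grade (V := V) p := by
    rw [VOA.isInternal.submodule_iSup_eq_top]; trivial
  exact Submodule.iSup_induction _ (motive := P) this hP h0 hadd

/-- The linear map `V → W` that is `F p` on the weight space `V_p`. -/
def wtLift (F : ℤ → V →ₗ[ℂ] W) : V →ₗ[ℂ] W :=
  DirectSum.toModule ℂ ℤ W (fun p => F p ∘ₗ (VOA.grade (V := V) p).subtype) ∘ₗ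
    (LinearEquiv.ofBijective (DirectSum.coeLinearMap (VOA.grade (V := V)))
      (show Function.Bijective (DirectSum.coeLinearMap (VOA.grade (V := V))) from
        VOA.isInternal)).symm.toLinearMap

lemma wtLift_of_mem (F : ℤ → V →ₗ[ℂ] W) {p : ℤ} {a : V} (ha : a ∈ VOA.grade (V := V) p) :
    wtLift F a = F p a := by
  have : (LinearEquiv.ofBijective (DirectSum.coeLinearMap (VOA.grade (V := V)))
      (show Function.Bijective (DirectSum.coeLinearMap (VOA.grade (V := V))) from
        VOA.isInternal)).symm a = DirectSum.lof ℂ ℤ (fun p => VOA.grade (V := V) p) p ⟨a, ha⟩ := by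
    rw [LinearEquiv.symm_apply_eq]
    rw [LinearEquiv.ofBijective_apply, DirectSum.lof_eq_of, DirectSum.coeLinearMap_of]
  simp [wtLift, this, DirectSum.toModule_lof]

lemma linearMap_ext_homogeneous {f g : V →ₗ[ℂ] W}
    (h : ∀ (p : ℤ), ∀ a ∈ VOA.grade (V := V) p, f a = g a) : f = g := by
  ext a
  exact homogeneous_induction (P := fun a => f a = g a) (by simp)
    (fun a b ha hb => by rw [map_add, map_add, ha, hb]) h a

lemma mem_grade_of_eigen {k : ℤ} {x : V} (hx : VOA.Y (VOA.conf : V) 1 x = (k : ℂ) • x) :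
    x ∈ VOA.grade (V := V) k := by
  set E := Module.End.eigenspace (VOA.Y (VOA.conf : V) 1) with hE
  have hle : ∀ n : ℤ, VOA.grade (V := V) n ≤ E (n : ℂ) := fun n a ha =>
    Module.End.mem_eigenspace_iff.2 (VOA.eigenspace n a ha)
  have hind : iSupIndep E := Module.End.eigenspaces_iSupIndep _
  have htop : x ∈ VOA.grade (V := V) k ⊔ ⨆ (n : ℤ) (_ : n ≠ k), VOA.grade (V := V) n := by
    rw [← iSup_split_single]
    rw [VOA.isInternal.submodule_iSup_eq_top]; trivial
  obtain ⟨y, hy, z, hz, rfl⟩ := Submodule.mem_sup.1 htop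
  have hz1 : z ∈ E (k : ℂ) := by
    have := (E (k : ℂ)).sub_mem (Module.End.mem_eigenspace_iff.2 hx) (hle k hy)
    simpa using this
  have hz2 : z ∈ ⨆ (μ : ℂ) (_ : μ ≠ k), E μ := by
    refine (iSup₂_le fun n hn => ?_ : (⨆ (n : ℤ) (_ : n ≠ k), VOA.grade (V := V) n) ≤ _) hz
    exact (hle n).trans (le_iSup₂_of_le (n : ℂ) (by exact_mod_cast hn) le_rfl)
  have : z = 0 := by
    have := (hind (k : ℂ)).le_bot ⟨hz1, hz2⟩
    simpa using this
  simpa [this] using hy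

lemma mode_mem_grade {p q : ℤ} {a b : V} (ha : a ∈ VOA.grade (V := V) p)
    (hb : b ∈ VOA.grade (V := V) q) (n : ℤ) :
    VOA.Y a n b ∈ VOA.grade (V := V) (p + q - n - 1) := by
  apply mem_grade_of_eigen
  obtain ⟨I₁, h₁⟩ := exists_trunc a b n
  obtain ⟨I₂, h₂⟩ := exists_trunc (VOA.conf : V) b 1
  obtain ⟨I₃, h₃⟩ := exists_trunc (VOA.conf : V) a 0
  have h := borcherds_range (VOA.conf : V) a b 0 1 n (max I₁ (max I₂ I₃) + 2)
    (fun i hi => h₁ i (by push_cast at hi; omega)) (fun i hi => h₂ i (by push_cast at hi; omega))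
    (fun i hi => h₃ i (by push_cast at hi; omega))
  set R := max I₁ (max I₂ I₃)
  rw [Finset.sum_range_succ', Finset.sum_eq_zero (by
      intro i _; rw [Ring.choose_zero_succ, mul_zero, zero_smul]),
    Finset.sum_range_succ', Finset.sum_eq_zero (s := Finset.range (R + 1)) (by
      intro i _; rw [Ring.choose_zero_succ, mul_zero, zero_smul]),
    Finset.sum_range_succ', Finset.sum_range_succ', Finset.sum_eq_zero (s := Finset.range R) (by
      intro i _
      rw [show (1 : ℤ) = ((1 : ℕ) : ℤ) by rfl, Ring.choose_natCast,
        Nat.choose_eq_zero_of_lt (by omega), Nat.cast_zero, zero_smul])] at h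
  simp only [Ring.choose_zero_right, Ring.choose_one_right, pow_zero, Nat.cast_zero, mul_one,
    zero_add, one_smul, add_zero, sub_zero, Int.negOnePow_zero, Units.val_one, Nat.cast_one] at h
  change VOA.Y (VOA.conf : V) 1 (VOA.Y a n b) - VOA.Y a n (VOA.Y (VOA.conf : V) 1 b)
    = VOA.Y (VOA.Y (VOA.conf : V) 1 a) (1 + n - 1) b
      + VOA.Y (VOA.Y (VOA.conf : V) 0 a) (1 + n) b at h
  rw [sub_eq_iff_eq_add.1 h, VOA.derivative, VOA.eigenspace p a ha, VOA.eigenspace q b hb,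
    add_sub_cancel_left, map_smul, map_smul, Pi.smul_apply, LinearMap.smul_apply,
    LinearMap.smul_apply, ← Int.cast_smul_eq_zsmul ℂ, ← add_smul, ← add_smul]
  congr 1
  push_cast; ring

lemma derivative_mem_grade {p : ℤ} {a : V} (ha : a ∈ VOA.grade (V := V) p) :
    VOA.Y (VOA.conf : V) 0 a ∈ VOA.grade (V := V) (p + 1) := by
  have := mode_mem_grade VOA.conf_mem ha 0
  rwa [show (2 : ℤ) + p - 0 - 1 = p + 1 by ring] at this

/-- `wtLift G` on a mode sum. -/
lemma wtLift_modeSum (G : ℤ → V →ₗ[ℂ] W) {p q l : ℤ} {a b : V}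
    (ha : a ∈ VOA.grade (V := V) p) (hb : b ∈ VOA.grade (V := V) q) (r : ℤ) {I : ℕ}
    (hI : ∀ i : ℤ, l + I ≤ i → VOA.Y a i b = 0) :
    wtLift G (modeSum r l a b)
      = ∑ i ∈ Finset.range I, (Ring.choose r i : ℤ) •
          G (p + q - l - 1 - i) (VOA.Y a (l + i) b) := by
  rw [modeSum_eq r l a b I hI, map_sum]
  refine Finset.sum_congr rfl fun i _ => ?_
  rw [map_zsmul]
  congr 1
  have := mode_mem_grade ha hb (l + i)
  rw [show p + q - (l + i) - 1 = p + q - l - 1 - (i : ℤ) by ring] at this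
  exact wtLift_of_mem G this

end Grading

/-! ### Zhu's algebra and its bimodules -/

section Zhu

variable (V : Type*) [AddCommGroup V] [Module ℂ V] [VOA V]
  (M : Type*) [AddCommGroup M] [Module ℂ M] [WeakModule V M]

/-- The left operation `a ∗ v = ∑_{j ≥ 0} (wt a choose j) a(j-1) v`. -/
def zhuStar : V →ₗ[ℂ] M →ₗ[ℂ] M := wtLift fun p => modeSum p (-1)

/-- The right operation `v ∗ a = ∑_{j ≥ 0} (wt a - 1 choose j) a(j-1) v` (arguments: `a`, `v`). -/
def zhuStarRight : V →ₗ[ℂ] M →ₗ[ℂ] M := wtLift fun p => modeSum (p - 1) (-1)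

/-- The operation `a ∘ v = ∑_{j ≥ 0} (wt a choose j) a(j-2) v`. -/
def zhuCirc : V →ₗ[ℂ] M →ₗ[ℂ] M := wtLift fun p => modeSum p (-2)

/-- The zero mode `o(a) = a(wt a - 1)`. -/
def zeroMode : V →ₗ[ℂ] Module.End ℂ M :=
  wtLift fun p => LinearMap.proj (p - 1) ∘ₗ WeakModule.Y

/-- `O(M)`, the span of all `a ∘ v`. -/
def zhuO : Submodule ℂ M := Submodule.span ℂ {x | ∃ (a : V) (v : M), x = zhuCirc V M a v}

variable {V M}

lemma zhuCirc_mem {p : ℤ} {a : V} (ha : a ∈ VOA.grade (V := V) p) (v : M) :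
    modeSum p (-2) a v ∈ zhuO V M := by
  refine Submodule.subset_span ⟨a, v, ?_⟩
  rw [zhuCirc, wtLift_of_mem _ ha]

lemma zhuO_le {N : Submodule ℂ M}
    (h : ∀ (p : ℤ), ∀ a ∈ VOA.grade (V := V) p, ∀ v : M, modeSum p (-2) a v ∈ N) :
    zhuO V M ≤ N := by
  refine Submodule.span_le.2 ?_
  rintro _ ⟨a, v, rfl⟩
  refine homogeneous_induction (P := fun a => zhuCirc V M a v ∈ N) ?_ ?_ ?_ a
  · simp
  · intro a b ha hb
    rw [map_add, LinearMap.add_apply]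
    exact N.add_mem ha hb
  · intro p a ha
    rw [zhuCirc, wtLift_of_mem _ ha]
    exact h p a ha v

lemma modeSum_mem_zhuO (n : ℕ) {p : ℤ} {a : V} (ha : a ∈ VOA.grade (V := V) p) (v : M) :
    modeSum p (-2 - n) a v ∈ zhuO V M := by
  induction n generalizing p a with
  | zero => simpa using zhuCirc_mem ha v
  | succ n ih =>
    have h1 := ih (derivative_mem_grade ha)
    rw [modeSum_derivative, modeSum_succ p (-2 - n - 1),
      show (-2 : ℤ) - n - 1 + 1 = -2 - n by ring, add_sub_cancel_right] at h1
    have h2 := ih ha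
    have h3 : ((2 + n : ℤ) : ℂ) • modeSum p (-2 - ((n + 1 : ℕ) : ℤ)) a v ∈ zhuO V M := by
      have := (zhuO V M).add_mem h1
        ((zhuO V M).smul_mem ((p + 1 - (2 + n) : ℤ) : ℂ) h2)
      convert this using 1
      rw [show (-2 : ℤ) - ((n + 1 : ℕ) : ℤ) = -2 - n - 1 by push_cast; ring]
      simp only [← Int.cast_smul_eq_zsmul ℂ]
      push_cast
      module
    have h4 : ((2 + n : ℤ) : ℂ) ≠ 0 := by
      have : (2 + n : ℤ) ≠ 0 := by omega
      exact_mod_cast this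
    have := (zhuO V M).smul_mem ((2 + n : ℤ) : ℂ)⁻¹ h3
    rwa [smul_smul, inv_mul_cancel₀ h4, one_smul] at this

lemma modeSum_mem_zhuO' {s : ℤ} (hs : s ≤ -2) {p : ℤ} {a : V}
    (ha : a ∈ VOA.grade (V := V) p) (v : M) : modeSum p s a v ∈ zhuO V M := by
  obtain ⟨n, hn⟩ := Int.le.dest hs
  have := modeSum_mem_zhuO n ha v
  rwa [show (-2 : ℤ) - n = s by omega] at this

lemma modeSum_succ_mem_zhuO {s : ℤ} (hs : s ≤ -3) {p : ℤ} {a : V}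
    (ha : a ∈ VOA.grade (V := V) p) (v : M) : modeSum (p + 1) s a v ∈ zhuO V M := by
  rw [modeSum_succ]
  exact (zhuO V M).add_mem (modeSum_mem_zhuO' (by omega) ha v)
    (modeSum_mem_zhuO' (by omega) ha v)

lemma zhuStar_of_mem {p : ℤ} {a : V} (ha : a ∈ VOA.grade (V := V) p) (v : M) :
    zhuStar V M a v = modeSum p (-1) a v := by rw [zhuStar, wtLift_of_mem _ ha]

lemma zhuStarRight_of_mem {p : ℤ} {a : V} (ha : a ∈ VOA.grade (V := V) p) (v : M) :
    zhuStarRight V M a v = modeSum (p - 1) (-1) a v := by rw [zhuStarRight, wtLift_of_mem _ ha]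

lemma zeroMode_of_mem {p : ℤ} {a : V} (ha : a ∈ VOA.grade (V := V) p) (v : M) :
    zeroMode V M a v = WeakModule.Y a (p - 1) v := by
  rw [zeroMode, wtLift_of_mem _ ha]; rfl

/-- `a ∗ O(M) ⊆ O(M)`. -/
lemma zhuStar_zhuO (a : V) {x : M} (hx : x ∈ zhuO V M) : zhuStar V M a x ∈ zhuO V M := by
  refine homogeneous_induction (P := fun a => zhuStar V M a x ∈ zhuO V M) ?_ ?_ ?_ a
  · simp
  · intro a b ha hb
    rw [map_add, LinearMap.add_apply]
    exact (zhuO V M).add_mem ha hb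
  intro p a ha
  suffices zhuO V M ≤ (zhuO V M).comap (zhuStar V M a) from this hx
  apply zhuO_le
  intro q b hb v
  rw [Submodule.mem_comap, zhuStar_of_mem ha]
  obtain ⟨I, hI, h, -⟩ := modeSum_borcherds a b v p q (-1) (-2)
  obtain ⟨J, rfl⟩ : ∃ J, I = J + 1 := ⟨I - 1, by omega⟩
  rw [Finset.sum_range_succ', sub_eq_iff_eq_add, ← eq_sub_iff_add_eq'] at h
  simp only [Nat.cast_zero, pow_zero, Ring.choose_zero_right, mul_one, one_smul, sub_zero,
    add_zero] at h
  rw [h]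
  refine (zhuO V M).sub_mem ((zhuO V M).add_mem ?_ ?_) ?_
  · refine Submodule.sum_mem _ fun i _ => zsmul_mem ?_ _
    have := mode_mem_grade ha hb (-1 + i)
    rw [show p + q - (-1 + (i : ℤ)) - 1 = p + q - i by ring] at this
    exact zhuCirc_mem this v
  · exact Submodule.sum_mem _ fun i _ => zsmul_mem (modeSum_mem_zhuO' (by omega) hb _) _
  · exact Submodule.sum_mem _ fun i _ => zsmul_mem
      (modeSum_mem_zhuO' (by push_cast; omega) ha _) _

/-- `O(V) ∗ v ⊆ O(M)`. -/
lemma zhuO_zhuStar {x : V} (hx : x ∈ zhuO V V) (v : M) : zhuStar V M x v ∈ zhuO V M := by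
  suffices zhuO V V ≤ (zhuO V M).comap ((zhuStar V M).flip v) from this hx
  apply zhuO_le
  intro p a ha b
  refine homogeneous_induction (P := fun b => modeSum p (-2) a b ∈
    (zhuO V M).comap ((zhuStar V M).flip v)) ?_ ?_ ?_ b
  · simp
  · intro b b' hb hb'
    rw [map_add]; exact Submodule.add_mem _ hb hb'
  intro q b hb
  rw [Submodule.mem_comap, LinearMap.flip_apply, zhuStar]
  obtain ⟨I, hI, h, -, -, h3⟩ := modeSum_borcherds a b v p (q + 1) (-2) (-1)
  rw [wtLift_modeSum _ ha hb p h3, LinearMap.sum_apply]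
  have e : ∑ i ∈ Finset.range I, ((Ring.choose p i : ℤ) •
      (modeSum (p + q - -2 - 1 - i) (-1) : V →ₗ[ℂ] M →ₗ[ℂ] M) (VOA.Y a (-2 + i) b)) v
      = ∑ i ∈ Finset.range I, (Ring.choose p i : ℤ) •
      modeSum (p + (q + 1) - i) (-1) (VOA.Y a (-2 + i) b) v :=
    Finset.sum_congr rfl fun i _ => by
      rw [LinearMap.smul_apply, show p + q - -2 - 1 - (i : ℤ) = p + (q + 1) - i by ring]
  rw [e, ← h]
  refine (zhuO V M).sub_mem ?_ ?_
  · exact Submodule.sum_mem _ fun i _ => zsmul_mem (modeSum_mem_zhuO' (by omega) ha _) _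
  · exact Submodule.sum_mem _ fun i _ => zsmul_mem (modeSum_succ_mem_zhuO (by omega) hb _) _

/-- `(a ∗ b) ∗ v - a ∗ (b ∗ v) ∈ O(M)`. -/
lemma zhuStar_assoc (a b : V) (v : M) :
    zhuStar V M (zhuStar V V a b) v - zhuStar V M a (zhuStar V M b v) ∈ zhuO V M := by
  refine homogeneous_induction (P := fun a => zhuStar V M (zhuStar V V a b) v
    - zhuStar V M a (zhuStar V M b v) ∈ zhuO V M) ?_ ?_ ?_ a
  · simp
  · intro a a' ha ha'
    convert (zhuO V M).add_mem ha ha' using 1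
    simp only [map_add, LinearMap.add_apply]; abel
  intro p a ha
  refine homogeneous_induction (P := fun b => zhuStar V M (zhuStar V V a b) v
    - zhuStar V M a (zhuStar V M b v) ∈ zhuO V M) ?_ ?_ ?_ b
  · simp
  · intro b b' hb hb'
    convert (zhuO V M).add_mem hb hb' using 1
    simp only [map_add, LinearMap.add_apply]; abel
  intro q b hb
  obtain ⟨I, hI, h, -, -, h3⟩ := modeSum_borcherds a b v p q (-1) (-1)
  rw [zhuStar_of_mem ha, zhuStar_of_mem ha, zhuStar_of_mem hb, zhuStar,
    wtLift_modeSum _ ha hb p h3, LinearMap.sum_apply]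
  have e : ∑ i ∈ Finset.range I, ((Ring.choose p i : ℤ) •
      (modeSum (p + q - -1 - 1 - i) (-1) : V →ₗ[ℂ] M →ₗ[ℂ] M) (VOA.Y a (-1 + i) b)) v
      = ∑ i ∈ Finset.range I, (Ring.choose p i : ℤ) •
      modeSum (p + q - i) (-1) (VOA.Y a (-1 + i) b) v :=
    Finset.sum_congr rfl fun i _ => by
      rw [LinearMap.smul_apply, show p + q - -1 - 1 - (i : ℤ) = p + q - i by ring]
  rw [e, ← h]
  obtain ⟨J, rfl⟩ : ∃ J, I = J + 1 := ⟨I - 1, by omega⟩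
  rw [Finset.sum_range_succ']
  simp only [Nat.cast_zero, pow_zero, Ring.choose_zero_right, mul_one, one_smul, sub_zero,
    add_zero]
  rw [add_sub_right_comm, add_sub_cancel_right]
  refine (zhuO V M).sub_mem ?_ ?_
  · exact Submodule.sum_mem _ fun i _ => zsmul_mem
      (modeSum_mem_zhuO' (by push_cast; omega) ha _) _
  · exact Submodule.sum_mem _ fun i _ => zsmul_mem (modeSum_mem_zhuO' (by omega) hb _) _

end Zhu

section Skew

variable {V : Type*} [AddCommGroup V] [Module ℂ V] [VOA V]
  {W : Type*} [AddCommGroup W] [Module ℂ W]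

lemma negOnePow_natCast' (n : ℕ) : (((n : ℤ).negOnePow : ℤˣ) : ℤ) = (-1) ^ n := by
  exact Int.coe_negOnePow_natCast n

lemma choose_neg_succ (x : ℤ) (n : ℕ) :
    Ring.choose (-(x + 1)) n = (-1) ^ n * Ring.choose (x + n) n := by
  rw [Ring.choose_neg, Units.smul_def, smul_eq_mul, negOnePow_natCast',
    show x + 1 + (n : ℤ) - 1 = x + n by ring]

lemma skew_vac (ε : V →ₗ[ℂ] W) (d : ℤ)
    (hε : ∀ r : ℤ, ∀ c ∈ VOA.grade (V := V) r, ε (VOA.Y (VOA.conf : V) 0 c) = (d - r) • ε c)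
    (i : ℕ) {r : ℤ} {c : V} (hc : c ∈ VOA.grade (V := V) r) :
    ε (VOA.Y c (-1 - i) VOA.vac) = (Ring.choose (d - r) i : ℤ) • ε c := by
  induction i generalizing r c with
  | zero => simp [VOA.creation]
  | succ i ih =>
    have h := ih (derivative_mem_grade hc)
    rw [VOA.derivative, hε r c hc, LinearMap.smul_apply, map_zsmul, smul_smul,
      show d - (r + 1) = d - r - 1 by ring, mul_comm, ← choose_succ_mul,
      show (-1 : ℤ) - i - 1 = -1 - ((i + 1 : ℕ) : ℤ) by push_cast; ring,
      show -(-1 - (i : ℤ)) = i + 1 by ring, mul_smul] at h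
    have h4 : (((i : ℤ) + 1 : ℤ) : ℂ) ≠ 0 := by
      have : (i : ℤ) + 1 ≠ 0 := by omega
      exact_mod_cast this
    rw [← Int.cast_smul_eq_zsmul ℂ, ← Int.cast_smul_eq_zsmul ℂ ((i : ℤ) + 1)] at h
    exact smul_right_injective W h4 h

lemma skew_mode (ε : V →ₗ[ℂ] W) (d : ℤ)
    (hε : ∀ r : ℤ, ∀ c ∈ VOA.grade (V := V) r, ε (VOA.Y (VOA.conf : V) 0 c) = (d - r) • ε c)
    {p q : ℤ} {a b : V} (ha : a ∈ VOA.grade (V := V) p) (hb : b ∈ VOA.grade (V := V) q)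
    (l : ℤ) {I : ℕ} (hI : ∀ i : ℤ, l + I ≤ i → VOA.Y a i b = 0) :
    ε (VOA.Y b l a) = ∑ i ∈ Finset.range I,
      (-(l.negOnePow : ℤ) * (-1) ^ i * Ring.choose (d - p - q + l + 1 + i) i) •
        ε (VOA.Y a (l + i) b) := by
  have h := borcherds_range a b (VOA.vac : V) l (-1) 0 (I + 1)
    (fun i hi => VOA.creation_of_nonneg b i (by push_cast at hi; omega))
    (fun i hi => VOA.creation_of_nonneg a i (by push_cast at hi; omega))
    (fun i hi => hI i (by push_cast at hi; omega))
  rw [Finset.sum_eq_zero (fun i _ => by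
      change _ • VOA.Y a _ (VOA.Y b (0 + i) VOA.vac) = 0
      rw [VOA.creation_of_nonneg b _ (by omega), map_zero, smul_zero]),
    Finset.sum_range_succ', Finset.sum_eq_zero (fun i _ => by
      change _ • VOA.Y b _ (VOA.Y a (-1 + ((i + 1 : ℕ) : ℤ)) VOA.vac) = 0
      rw [VOA.creation_of_nonneg a _ (by push_cast; omega), map_zero, smul_zero]),
    Finset.sum_range_succ, hI _ le_rfl] at h
  simp only [pow_zero, Nat.cast_zero, add_zero, sub_zero, Ring.choose_zero_right, mul_one,
    one_mul, zero_add, zero_sub, map_zero, Pi.zero_apply, LinearMap.zero_apply, smul_zero] at h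
  change -((l.negOnePow : ℤ) • VOA.Y b l (VOA.Y a (-1) VOA.vac))
    = ∑ i ∈ Finset.range I, (Ring.choose (-1 : ℤ) i : ℤ) •
      VOA.Y (VOA.Y a (l + i) b) (-1 - i) VOA.vac at h
  rw [VOA.creation] at h
  have h' := congrArg (fun x => (l.negOnePow : ℤ) • ε x) h
  simp only [map_neg, map_zsmul, map_sum, smul_neg, smul_smul] at h'
  have hl : (l.negOnePow : ℤ) * (l.negOnePow : ℤ) = 1 := by
    rw [← Units.val_mul, ← Int.negOnePow_add, Int.negOnePow_even _ (Even.add_self l)]; rfl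
  rw [hl, one_smul] at h'
  rw [neg_eq_iff_eq_neg] at h'
  rw [h', Finset.smul_sum, ← Finset.sum_neg_distrib]
  refine Finset.sum_congr rfl fun i _ => ?_
  have hm := mode_mem_grade ha hb (l + i)
  rw [skew_vac ε d hε i hm, smul_smul, smul_smul, ← neg_smul]
  congr 1
  have h1 : (Ring.choose (-1 : ℤ) i : ℤ) = (-1) ^ i := by
    have := choose_neg_succ 0 i
    simpa [Ring.choose_natCast] using this
  rw [h1, show d - (p + q - (l + i) - 1) = d - p - q + l + 1 + (i : ℤ) by ring]
  ring

/-- Skew-symmetry. -/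
lemma skew_modeSum (ε : V →ₗ[ℂ] W) (d : ℤ)
    (hε : ∀ r : ℤ, ∀ c ∈ VOA.grade (V := V) r, ε (VOA.Y (VOA.conf : V) 0 c) = (d - r) • ε c)
    {p q : ℤ} {a b : V} (ha : a ∈ VOA.grade (V := V) p) (hb : b ∈ VOA.grade (V := V) q)
    (k s : ℤ) :
    ε (modeSum k s b a)
      = (-(s.negOnePow : ℤ)) • ε (modeSum (p + q - d - s - 2 - k) s a b) := by
  obtain ⟨N₁, h₁⟩ := exists_trunc a b s
  obtain ⟨N₂, h₂⟩ := exists_trunc b a s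
  obtain ⟨N, hN₁, hN₂⟩ : ∃ N, N₁ ≤ N ∧ N₂ ≤ N := ⟨max N₁ N₂, by omega, by omega⟩
  rw [modeSum_eq k s b a N (fun n hn => h₂ n (by omega)),
    modeSum_eq _ s a b N (fun n hn => h₁ n (by omega)), map_sum, map_sum, Finset.smul_sum]
  have e : ∀ j ∈ Finset.range N, ε ((Ring.choose k j : ℤ) • WeakModule.Y b (s + j) a)
      = ∑ i ∈ Finset.range N, (Ring.choose k j * (-(s.negOnePow : ℤ) * (-1) ^ (j + i) *
          Ring.choose (d - p - q + s + 1 + ((j + i : ℕ) : ℤ)) i)) •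
        ε (VOA.Y a (s + ((j + i : ℕ) : ℤ)) b) := by
    intro j _
    rw [map_zsmul]
    change _ • ε (VOA.Y b (s + j) a) = _
    rw [skew_mode ε d hε ha hb (s + j) (I := N) (fun n hn => h₁ n (by omega)), Finset.smul_sum]
    refine Finset.sum_congr rfl fun i _ => ?_
    rw [smul_smul, show s + (j : ℤ) + i = s + ((j + i : ℕ) : ℤ) by push_cast; ring]
    congr 1
    have : ((s + j).negOnePow : ℤ) = s.negOnePow * (-1) ^ j := by
      rw [Int.negOnePow_add, Units.val_mul, negOnePow_natCast']
    rw [this, show d - p - q + (s + (j : ℤ)) + 1 + i = d - p - q + s + 1 + ((j + i : ℕ) : ℤ) by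
      push_cast; ring, pow_add]
    ring
  rw [Finset.sum_congr rfl e, sum_box N (fun j i => Ring.choose k j * (-(s.negOnePow : ℤ) *
      (-1) ^ (j + i) * Ring.choose (d - p - q + s + 1 + ((j + i : ℕ) : ℤ)) i))
      (fun n => ε (VOA.Y a (s + n) b)) (fun n hn => by rw [show VOA.Y a (s + n) b = 0 from
        h₁ _ (by omega), map_zero])]
  refine Finset.sum_congr rfl fun n _ => ?_
  rw [map_zsmul, smul_smul]
  congr 1
  have e2 : ∀ x ∈ Finset.HasAntidiagonal.antidiagonal n, Ring.choose k x.1 *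
      (-(s.negOnePow : ℤ) * (-1) ^ (x.1 + x.2) *
        Ring.choose (d - p - q + s + 1 + ((x.1 + x.2 : ℕ) : ℤ)) x.2)
      = (-(s.negOnePow : ℤ) * (-1) ^ n) * (Ring.choose k x.1 *
        Ring.choose (d - p - q + s + 1 + (n : ℤ)) x.2) := by
    intro x hx
    rw [Finset.HasAntidiagonal.mem_antidiagonal.1 hx]
    ring
  rw [Finset.sum_congr rfl e2, ← Finset.mul_sum, ← Ring.add_choose_eq n (Commute.all _ _),
    mul_assoc]
  congr 1
  rw [show p + q - d - s - 2 - k = -(k + (d - p - q + s + 1) + 1) by ring, choose_neg_succ,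
    show k + (d - p - q + s + 1 + (n : ℤ)) = k + (d - p - q + s + 1) + n by ring]

end Skew

section ZhuAlgebra

variable {V : Type*} [AddCommGroup V] [Module ℂ V] [VOA V]
  {M : Type*} [AddCommGroup M] [Module ℂ M] [WeakModule V M]

/-- The commutator formula for mode sums. -/
lemma modeSum_commutator (a b : V) (u : M) (p q t : ℤ) :
    ∃ I : ℕ, modeSum p 0 a (modeSum q t b u) - modeSum q t b (modeSum p 0 a u)
      = (∑ i ∈ Finset.range I, (Ring.choose p i : ℤ) •
          modeSum (p + q - i) t (VOA.Y a i b) u) ∧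
      (∀ i : ℤ, I ≤ i → VOA.Y a i b = 0) := by
  obtain ⟨I, hI, h, -, -, h3⟩ := modeSum_borcherds a b u p q 0 t
  refine ⟨I, ?_, fun i hi => h3 i (by omega)⟩
  simp only [zero_add] at h
  rw [← h]
  obtain ⟨J, rfl⟩ : ∃ J, I = J + 1 := ⟨I - 1, by omega⟩
  rw [Finset.sum_range_succ', Finset.sum_range_succ', Finset.sum_eq_zero (fun i _ => by
      rw [Ring.choose_zero_succ, mul_zero, zero_smul]),
    Finset.sum_eq_zero (fun i _ => by rw [Ring.choose_zero_succ, mul_zero, zero_smul])]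
  simp

lemma modeSum_commutator_wtLift {p q : ℤ} {a b : V} (ha : a ∈ VOA.grade (V := V) p)
    (hb : b ∈ VOA.grade (V := V) q) (u : M) (r k t : ℤ) :
    modeSum r 0 a (modeSum k t b u) - modeSum k t b (modeSum r 0 a u)
      = wtLift (fun w => modeSum (r + k + w - p - q + 1) t) (modeSum r 0 a b) u := by
  obtain ⟨I, h, h3⟩ := modeSum_commutator a b u r k t
  rw [h, wtLift_modeSum _ ha hb r (I := I) (fun i hi => h3 i (by omega)), LinearMap.sum_apply]
  refine Finset.sum_congr rfl fun i _ => ?_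
  rw [LinearMap.smul_apply, zero_add,
    show r + k + (p + q - 0 - 1 - (i : ℤ)) - p - q + 1 = r + k - i by ring]

lemma mode_neg_two_vac (c : V) : VOA.Y c (-2) VOA.vac = VOA.Y (VOA.conf : V) 0 c := by
  have := VOA.derivative c (-1)
  have h := congrArg (fun f => f VOA.vac) this
  simp only [neg_neg, one_smul] at h
  rw [VOA.creation] at h
  exact h.symm

lemma derivative_add_weight_mem {r : ℤ} {c : V} (hc : c ∈ VOA.grade (V := V) r) :
    VOA.Y (VOA.conf : V) 0 c + r • c ∈ zhuO V V := by
  have h := zhuCirc_mem (M := V) hc VOA.vac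
  rw [modeSum_eq r (-2) c _ 2 (fun n hn => VOA.creation_of_nonneg c n (by push_cast at hn; omega)),
    Finset.sum_range_succ, Finset.sum_range_one] at h
  have e : ((0 : ℕ) : ℤ) = 0 ∧ ((1 : ℕ) : ℤ) = 1 := ⟨rfl, rfl⟩
  rw [e.1, e.2, Ring.choose_zero_right, Ring.choose_one_right, one_smul] at h
  change VOA.Y c (-2) VOA.vac + r • VOA.Y c (-1) VOA.vac ∈ _ at h
  rwa [mode_neg_two_vac, VOA.creation] at h

/-- `a ∗ b - b ∗ a ≡ ∑_j (wt a - 1 choose j) a(j) b` modulo `O(V)`. -/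
lemma zhuStar_commutator {p q : ℤ} {a b : V} (ha : a ∈ VOA.grade (V := V) p)
    (hb : b ∈ VOA.grade (V := V) q) :
    zhuStar V V a b - zhuStar V V b a - modeSum (p - 1) 0 a b ∈ zhuO V V := by
  have h := skew_modeSum (zhuO V V).mkQ 0 (fun r c hc => by
    have := derivative_add_weight_mem hc
    rw [← Submodule.Quotient.mk_eq_zero] at this
    rw [zero_sub, neg_smul, eq_neg_iff_add_eq_zero, ← map_zsmul, ← map_add]
    exact this) ha hb q (-1)
  rw [show p + q - 0 - -1 - 2 - q = p - 1 by ring, Int.negOnePow_neg, Int.negOnePow_one,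
    Units.val_neg, Units.val_one, neg_neg, one_smul, ← sub_eq_zero, ← map_sub] at h
  have h' := (Submodule.Quotient.mk_eq_zero _).1 h
  have h1 := modeSum_succ (p - 1) (-1) a b
  rw [sub_add_cancel] at h1
  rw [zhuStar_of_mem ha, zhuStar_of_mem hb, h1]
  convert (zhuO V V).neg_mem h' using 1
  rw [show (-1 : ℤ) + 1 = 0 by ring]
  abel

lemma zhuStarRight_eq {p : ℤ} {a : V} (ha : a ∈ VOA.grade (V := V) p) (v : M) :
    zhuStarRight V M a v = zhuStar V M a v - modeSum (p - 1) 0 a v := by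
  have h1 := modeSum_succ (p - 1) (-1) a v
  rw [sub_add_cancel, show (-1 : ℤ) + 1 = 0 by ring] at h1
  rw [zhuStar_of_mem ha, zhuStarRight_of_mem ha, h1, add_sub_cancel_right]

/-- `a ∗ (v ∗ b) - (a ∗ v) ∗ b ∈ O(M)`. -/
lemma zhuStar_zhuStarRight (a b : V) (v : M) :
    zhuStar V M a (zhuStarRight V M b v) - zhuStarRight V M b (zhuStar V M a v) ∈ zhuO V M := by
  refine homogeneous_induction (P := fun a => zhuStar V M a (zhuStarRight V M b v) -
    zhuStarRight V M b (zhuStar V M a v) ∈ zhuO V M) ?_ ?_ ?_ a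
  · simp
  · intro a a' ha ha'
    convert (zhuO V M).add_mem ha ha' using 1
    simp only [map_add, LinearMap.add_apply]; abel
  intro p a ha
  refine homogeneous_induction (P := fun b => zhuStar V M a (zhuStarRight V M b v) -
    zhuStarRight V M b (zhuStar V M a v) ∈ zhuO V M) ?_ ?_ ?_ b
  · simp
  · intro b b' hb hb'
    convert (zhuO V M).add_mem hb hb' using 1
    simp only [map_add, LinearMap.add_apply]; abel
  intro q b hb
  rw [zhuStarRight_eq hb, zhuStarRight_eq hb, map_sub]
  have hc := modeSum_commutator_wtLift hb ha v (q - 1) p (-1)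
  have hc' : wtLift (fun w => modeSum (q - 1 + p + w - q - p + 1) (-1)) (modeSum (q - 1) 0 b a) v
      = zhuStar V M (modeSum (q - 1) 0 b a) v := by
    rw [zhuStar]
    congr 3
    funext w
    rw [show q - 1 + p + w - q - p + 1 = w by ring]
  rw [hc', ← zhuStar_of_mem ha, ← zhuStar_of_mem ha] at hc
  have h1 := zhuStar_assoc a b v
  have h2 := zhuStar_assoc b a v
  have h3 := zhuO_zhuStar (zhuStar_commutator hb ha) v
  have := (zhuO V M).sub_mem ((zhuO V M).sub_mem h2 h1) h3
  convert this using 1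
  rw [map_sub, map_sub, LinearMap.sub_apply, LinearMap.sub_apply, ← hc]
  abel

lemma zhuStar_vac (v : M) : zhuStar V M VOA.vac v = v := by
  rw [zhuStar_of_mem VOA.vac_mem, modeSum_vac]

lemma zhuStar_vac_right (a : V) : zhuStar V V a VOA.vac = a := by
  refine homogeneous_induction (P := fun a => zhuStar V V a VOA.vac = a) ?_ ?_ ?_ a
  · simp
  · intro a b ha hb
    rw [map_add, LinearMap.add_apply, ha, hb]
  intro p a ha
  rw [zhuStar_of_mem ha, modeSum_eq p (-1) a _ 1
    (fun n hn => VOA.creation_of_nonneg a n (by push_cast at hn; omega))]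
  simp only [Finset.sum_range_one, Ring.choose_zero_right, Nat.cast_zero, add_zero, one_smul]
  exact VOA.creation a

variable (V M)

/-- Zhu's algebra `A(V) = V / O(V)`. -/
def ZhuAlgebra (V : Type*) [AddCommGroup V] [Module ℂ V] [VOA V] : Type _ := V ⧸ zhuO V V

instance : AddCommGroup (ZhuAlgebra V) := inferInstanceAs (AddCommGroup (V ⧸ zhuO V V))
instance : Module ℂ (ZhuAlgebra V) := inferInstanceAs (Module ℂ (V ⧸ zhuO V V))

/-- `A(M) = M / O(M)`. -/
def ZhuBimodule (V M : Type*) [AddCommGroup V] [Module ℂ V] [VOA V]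
    [AddCommGroup M] [Module ℂ M] [WeakModule V M] : Type _ := M ⧸ zhuO V M

instance : AddCommGroup (ZhuBimodule V M) := inferInstanceAs (AddCommGroup (M ⧸ zhuO V M))
instance : Module ℂ (ZhuBimodule V M) := inferInstanceAs (Module ℂ (M ⧸ zhuO V M))

variable {V M}

/-- The class `[a] ∈ A(V)`. -/
def ZhuAlgebra.mk : V →ₗ[ℂ] ZhuAlgebra V := (zhuO V V).mkQ

/-- The class `[v] ∈ A(M)`. -/
def ZhuBimodule.mk (V : Type*) {M : Type*} [AddCommGroup V] [Module ℂ V] [VOA V]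
    [AddCommGroup M] [Module ℂ M] [WeakModule V M] : M →ₗ[ℂ] ZhuBimodule V M := (zhuO V M).mkQ

lemma ZhuAlgebra.mk_surjective : Function.Surjective (ZhuAlgebra.mk : V → ZhuAlgebra V) :=
  (zhuO V V).mkQ_surjective

lemma ZhuBimodule.mk_surjective :
    Function.Surjective (ZhuBimodule.mk V : M → ZhuBimodule V M) :=
  (zhuO V M).mkQ_surjective

lemma ZhuAlgebra.mk_eq_zero {a : V} : ZhuAlgebra.mk a = 0 ↔ a ∈ zhuO V V :=
  Submodule.Quotient.mk_eq_zero _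

lemma ZhuBimodule.mk_eq_zero {v : M} : ZhuBimodule.mk V v = 0 ↔ v ∈ zhuO V M :=
  Submodule.Quotient.mk_eq_zero _

lemma ZhuAlgebra.mk_eq {a b : V} : ZhuAlgebra.mk a = ZhuAlgebra.mk b ↔ a - b ∈ zhuO V V := by
  rw [← ZhuAlgebra.mk_eq_zero, map_sub, sub_eq_zero]

lemma ZhuBimodule.mk_eq {v w : M} :
    ZhuBimodule.mk V v = ZhuBimodule.mk V w ↔ v - w ∈ zhuO V M := by
  rw [← ZhuBimodule.mk_eq_zero, map_sub, sub_eq_zero]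

variable (V M)

/-- The left action of `V` on `A(M)`, `a.[v] = [a ∗ v]`. -/
def zhuLeftV : V →ₗ[ℂ] Module.End ℂ (ZhuBimodule V M) where
  toFun a := (zhuO V M).mapQ (zhuO V M) (zhuStar V M a) fun _ hx => zhuStar_zhuO a hx
  map_add' a b := by
    refine LinearMap.ext fun x => ?_
    obtain ⟨v, rfl⟩ := ZhuBimodule.mk_surjective x
    change ZhuBimodule.mk V _ = ZhuBimodule.mk V _ + ZhuBimodule.mk V _
    rw [map_add, LinearMap.add_apply, map_add]
  map_smul' c a := by
    refine LinearMap.ext fun x => ?_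
    obtain ⟨v, rfl⟩ := ZhuBimodule.mk_surjective x
    change ZhuBimodule.mk V _ = c • ZhuBimodule.mk V _
    rw [map_smul, LinearMap.smul_apply, map_smul]

/-- The left action of `A(V)` on `A(M)`, `[a].[v] = [a ∗ v]`. -/
def zhuLeft : ZhuAlgebra V →ₗ[ℂ] Module.End ℂ (ZhuBimodule V M) :=
  (zhuO V V).liftQ (zhuLeftV V M) fun a ha => by
    rw [LinearMap.mem_ker]
    refine LinearMap.ext fun x => ?_
    obtain ⟨v, rfl⟩ := ZhuBimodule.mk_surjective x
    exact ZhuBimodule.mk_eq_zero.2 (zhuO_zhuStar ha v)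

lemma zhuLeft_mk (a : V) (v : M) :
    zhuLeft V M (ZhuAlgebra.mk a) (ZhuBimodule.mk V v) = ZhuBimodule.mk V (zhuStar V M a v) := rfl

/-- The product `[a] ∗ [b] = [a ∗ b]` of `A(V)`. -/
def zhuMul : ZhuAlgebra V →ₗ[ℂ] ZhuAlgebra V →ₗ[ℂ] ZhuAlgebra V := zhuLeft V V

lemma zhuMul_mk (a b : V) :
    zhuMul V (ZhuAlgebra.mk a) (ZhuAlgebra.mk b) = ZhuAlgebra.mk (zhuStar V V a b) := rfl

instance : Ring (ZhuAlgebra V) where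
  __ := (inferInstance : AddCommGroup (ZhuAlgebra V))
  mul x y := zhuMul V x y
  one := ZhuAlgebra.mk VOA.vac
  left_distrib x y z := map_add (zhuMul V x) y z
  right_distrib x y z := LinearMap.congr_fun (map_add (zhuMul V) x y) z
  zero_mul x := LinearMap.congr_fun (map_zero (zhuMul V)) x
  mul_zero x := map_zero (zhuMul V x)
  mul_assoc x y z := by
    obtain ⟨a, rfl⟩ := ZhuAlgebra.mk_surjective x
    obtain ⟨b, rfl⟩ := ZhuAlgebra.mk_surjective y
    obtain ⟨c, rfl⟩ := ZhuAlgebra.mk_surjective z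
    change ZhuAlgebra.mk _ = ZhuAlgebra.mk _
    exact ZhuAlgebra.mk_eq.2 (zhuStar_assoc a b c)
  one_mul x := by
    obtain ⟨a, rfl⟩ := ZhuAlgebra.mk_surjective x
    change ZhuAlgebra.mk _ = ZhuAlgebra.mk _
    rw [zhuStar_vac]
  mul_one x := by
    obtain ⟨a, rfl⟩ := ZhuAlgebra.mk_surjective x
    change ZhuAlgebra.mk _ = ZhuAlgebra.mk _
    rw [zhuStar_vac_right]

variable {V M}

lemma ZhuAlgebra.mk_mul (a b : V) :
    (ZhuAlgebra.mk a * ZhuAlgebra.mk b : ZhuAlgebra V) = ZhuAlgebra.mk (zhuStar V V a b) := rfl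

lemma ZhuAlgebra.mk_vac : (ZhuAlgebra.mk VOA.vac : ZhuAlgebra V) = 1 := rfl

instance : Algebra ℂ (ZhuAlgebra V) :=
  Algebra.ofModule (fun c x y => LinearMap.congr_fun (map_smul (zhuMul V) c x) y)
    (fun c x y => map_smul (zhuMul V x) c y)

/-- The left `A(V)`-module structure of `A(M)`: `[a].[v] = [a ∗ v]`. -/
instance : Module (ZhuAlgebra V) (ZhuBimodule V M) where
  smul x y := zhuLeft V M x y
  one_smul y := by
    obtain ⟨v, rfl⟩ := ZhuBimodule.mk_surjective y
    change ZhuBimodule.mk V _ = ZhuBimodule.mk V _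
    rw [zhuStar_vac]
  mul_smul x y z := by
    obtain ⟨a, rfl⟩ := ZhuAlgebra.mk_surjective x
    obtain ⟨b, rfl⟩ := ZhuAlgebra.mk_surjective y
    obtain ⟨c, rfl⟩ := ZhuBimodule.mk_surjective z
    change ZhuBimodule.mk V _ = ZhuBimodule.mk V _
    exact ZhuBimodule.mk_eq.2 (zhuStar_assoc a b c)
  smul_zero x := map_zero (zhuLeft V M x)
  smul_add x y z := map_add (zhuLeft V M x) y z
  add_smul x y z := LinearMap.congr_fun (map_add (zhuLeft V M) x y) z
  zero_smul x := LinearMap.congr_fun (map_zero (zhuLeft V M)) x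

lemma ZhuBimodule.smul_mk (a : V) (v : M) :
    ZhuAlgebra.mk a • ZhuBimodule.mk V v = ZhuBimodule.mk V (zhuStar V M a v) := rfl

instance : IsScalarTower ℂ (ZhuAlgebra V) (ZhuBimodule V M) where
  smul_assoc c x y := LinearMap.congr_fun (map_smul (zhuLeft V M) c x) y

end ZhuAlgebra

/-! ### The bottom degree -/

section Bottom

variable (V : Type*) [AddCommGroup V] [Module ℂ V] [VOA V]
  (M : Type*) [AddCommGroup M] [Module ℂ M] [AdmissibleModule V M]

/-- The bottom degree `M(0)` of an admissible module. -/
abbrev Bottom : Type _ := AdmissibleModule.grade (V := V) (M := M) 0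

/-- `M` is generated by its bottom degree: `M` is the only `V`-stable subspace containing `M(0)`. -/
def GeneratedByBottom : Prop :=
  ∀ N : Submodule ℂ M, AdmissibleModule.grade (V := V) (M := M) 0 ≤ N →
    (∀ (a : V) (n : ℤ), ∀ u ∈ N, WeakModule.Y a n u ∈ N) → N = ⊤

variable {V M}

lemma zeroMode_mem_bottom (a : V) {w : M} (hw : w ∈ AdmissibleModule.grade (V := V) (M := M) 0) :
    zeroMode V M a w ∈ AdmissibleModule.grade (V := V) (M := M) 0 := by
  refine homogeneous_induction (P := fun a => zeroMode V M a w ∈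
    AdmissibleModule.grade (V := V) (M := M) 0) ?_ ?_ ?_ a
  · simp
  · intro a b ha hb
    rw [map_add, LinearMap.add_apply]
    exact Submodule.add_mem _ ha hb
  intro p a ha
  rw [zeroMode_of_mem ha]
  exact AdmissibleModule.grading p a ha _ 0 w hw 0 (by push_cast; ring)

lemma mode_bottom_eq_zero {p : ℤ} {a : V} (ha : a ∈ VOA.grade (V := V) p) {w : M}
    (hw : w ∈ AdmissibleModule.grade (V := V) (M := M) 0) {n : ℤ} (hn : p ≤ n) :
    WeakModule.Y a n w = 0 :=
  AdmissibleModule.grading_neg p a ha n 0 w hw (by push_cast; omega)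

lemma zeroMode_modeSum {p q : ℤ} {a b : V} (ha : a ∈ VOA.grade (V := V) p)
    (hb : b ∈ VOA.grade (V := V) q) (w : M) (l n : ℤ) (hn : n = q - l - 2) {I : ℕ}
    (h3 : ∀ i : ℤ, l + I ≤ i → VOA.Y a i b = 0) :
    zeroMode V M (modeSum p l a b) w = ∑ i ∈ Finset.range I, (Ring.choose p i : ℤ) •
      WeakModule.Y (VOA.Y a (l + i) b) (p + n - i) w := by
  rw [zeroMode, wtLift_modeSum _ ha hb p h3, LinearMap.sum_apply]
  refine Finset.sum_congr rfl fun i _ => ?_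
  rw [LinearMap.smul_apply, LinearMap.comp_apply, LinearMap.proj_apply,
    show p + q - l - 1 - (i : ℤ) - 1 = p + n - i by rw [hn]; ring]

lemma zeroMode_zhuO {x : V} (hx : x ∈ zhuO V V) {w : M}
    (hw : w ∈ AdmissibleModule.grade (V := V) (M := M) 0) : zeroMode V M x w = 0 := by
  suffices zhuO V V ≤ LinearMap.ker ((zeroMode V M).flip w) from this hx
  apply zhuO_le
  intro p a ha b
  refine homogeneous_induction (P := fun b => modeSum p (-2) a b ∈
    LinearMap.ker ((zeroMode V M).flip w)) ?_ ?_ ?_ b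
  · simp
  · intro b b' hb hb'
    rw [map_add]; exact Submodule.add_mem _ hb hb'
  intro q b hb
  rw [LinearMap.mem_ker, LinearMap.flip_apply]
  obtain ⟨I₁, h₁⟩ := exists_trunc b w q
  obtain ⟨I₂, h₂⟩ := exists_trunc a w p
  obtain ⟨I₃, h₃⟩ := exists_trunc a b (-2)
  obtain ⟨I, hI₁, hI₂, hI₃⟩ : ∃ I, I₁ ≤ I ∧ I₂ ≤ I ∧ I₃ ≤ I :=
    ⟨max I₁ (max I₂ I₃), by omega, by omega, by omega⟩
  have h3 : ∀ i : ℤ, -2 + I ≤ i → VOA.Y a i b = 0 := fun i hi => h₃ i (by omega)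
  rw [zeroMode_modeSum ha hb w (-2) q (by ring) h3,
    ← borcherds_range a b w (-2) p q I (fun i hi => h₁ i (by omega))
    (fun i hi => h₂ i (by omega)) h3, Finset.sum_eq_zero, Finset.sum_eq_zero, sub_zero]
  · intro i _
    rw [mode_bottom_eq_zero ha hw (by omega), map_zero, smul_zero]
  · intro i _
    rw [mode_bottom_eq_zero hb hw (by omega), map_zero, smul_zero]

lemma zeroMode_zhuStar (a b : V) {w : M}
    (hw : w ∈ AdmissibleModule.grade (V := V) (M := M) 0) :
    zeroMode V M (zhuStar V V a b) w = zeroMode V M a (zeroMode V M b w) := by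
  refine homogeneous_induction (P := fun a => zeroMode V M (zhuStar V V a b) w
    = zeroMode V M a (zeroMode V M b w)) ?_ ?_ ?_ a
  · simp
  · intro a a' ha ha'
    simp only [map_add, LinearMap.add_apply, ha, ha']
  intro p a ha
  refine homogeneous_induction (P := fun b => zeroMode V M (zhuStar V V a b) w
    = zeroMode V M a (zeroMode V M b w)) ?_ ?_ ?_ b
  · simp
  · intro b b' hb hb'
    simp only [map_add, LinearMap.add_apply, hb, hb']
  intro q b hb
  obtain ⟨I₁, h₁⟩ := exists_trunc b w (q - 1)
  obtain ⟨I₂, h₂⟩ := exists_trunc a w p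
  obtain ⟨I₃, h₃⟩ := exists_trunc a b (-1)
  obtain ⟨J, hI₁, hI₂, hI₃⟩ : ∃ J, I₁ ≤ J + 1 ∧ I₂ ≤ J + 1 ∧ I₃ ≤ J + 1 :=
    ⟨max I₁ (max I₂ I₃), by omega, by omega, by omega⟩
  have h3 : ∀ i : ℤ, -1 + ((J + 1 : ℕ) : ℤ) ≤ i → VOA.Y a i b = 0 :=
    fun i hi => h₃ i (by push_cast at hi; omega)
  rw [zhuStar_of_mem ha, zeroMode_modeSum ha hb w (-1) (q - 1) (by ring) h3,
    ← borcherds_range a b w (-1) p (q - 1) (J + 1) (fun i hi => h₁ i (by push_cast at hi; omega))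
    (fun i hi => h₂ i (by push_cast at hi; omega)) h3, Finset.sum_range_succ',
    Finset.sum_eq_zero, Finset.sum_eq_zero, sub_zero, zero_add, zeroMode_of_mem ha,
    zeroMode_of_mem hb]
  · simp [sub_eq_add_neg]
  · intro i _
    rw [mode_bottom_eq_zero ha hw (by omega), map_zero, smul_zero]
  · intro i _
    rw [mode_bottom_eq_zero hb hw (by push_cast; omega), map_zero, smul_zero]

variable (V M)

/-- The action of `V` on `M(0)` by zero modes. -/
def bottomActV : V →ₗ[ℂ] Module.End ℂ (Bottom V M) where
  toFun a := (zeroMode V M a).restrict fun _ hw => zeroMode_mem_bottom a hw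
  map_add' a b := by ext w; simp
  map_smul' c a := by ext w; simp

/-- The action of `A(V)` on `M(0)`: `[a]` acts as `o(a)`. -/
def bottomAct : ZhuAlgebra V →ₗ[ℂ] Module.End ℂ (Bottom V M) :=
  (zhuO V V).liftQ (bottomActV V M) fun a ha => by
    rw [LinearMap.mem_ker]
    refine LinearMap.ext fun w => Subtype.ext ?_
    exact zeroMode_zhuO ha w.2

/-- The left `A(V)`-module structure of `M(0)`: `[a].w = o(a) w`. -/
instance : Module (ZhuAlgebra V) (Bottom V M) where
  smul x y := bottomAct V M x y
  one_smul w := by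
    refine Subtype.ext ?_
    change zeroMode V M VOA.vac w = w
    rw [zeroMode_of_mem VOA.vac_mem, WeakModule.vacuum]; simp
  mul_smul x y w := by
    obtain ⟨a, rfl⟩ := ZhuAlgebra.mk_surjective x
    obtain ⟨b, rfl⟩ := ZhuAlgebra.mk_surjective y
    exact Subtype.ext (zeroMode_zhuStar a b w.2)
  smul_zero x := map_zero (bottomAct V M x)
  smul_add x y z := map_add (bottomAct V M x) y z
  add_smul x y z := LinearMap.congr_fun (map_add (bottomAct V M) x y) z
  zero_smul x := LinearMap.congr_fun (map_zero (bottomAct V M)) x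

lemma Bottom.coe_smul (a : V) (w : Bottom V M) :
    ((ZhuAlgebra.mk a • w : Bottom V M) : M) = zeroMode V M a w := rfl

instance : IsScalarTower ℂ (ZhuAlgebra V) (Bottom V M) where
  smul_assoc c x y := LinearMap.congr_fun (map_smul (bottomAct V M) c x) y

end Bottom

/-! ### The tensor product over Zhu's algebra -/

section ZhuTensor

variable (V : Type*) [AddCommGroup V] [Module ℂ V] [VOA V]
  (M : Type*) [AddCommGroup M] [Module ℂ M] [WeakModule V M]
  (U : Type*) [AddCommGroup U] [Module ℂ U] [Module (ZhuAlgebra V) U]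

/-- The relations `[v].[a] ⊗ u = [v] ⊗ [a].u`, with `[v].[a] = [v ∗ a]`. -/
def zhuTensorRel : Submodule ℂ (ZhuBimodule V M ⊗[ℂ] U) :=
  Submodule.span ℂ {x | ∃ (v : M) (a : V) (u : U),
    x = ZhuBimodule.mk V (zhuStarRight V M a v) ⊗ₜ[ℂ] u
      - ZhuBimodule.mk V v ⊗ₜ[ℂ] (ZhuAlgebra.mk a • u)}

/-- The tensor product `A(M) ⊗_{A(V)} U` of the bimodule `A(M)` with a left `A(V)`-module `U`. -/
def ZhuTensor : Type _ := (ZhuBimodule V M ⊗[ℂ] U) ⧸ zhuTensorRel V M U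

instance : AddCommGroup (ZhuTensor V M U) :=
  inferInstanceAs (AddCommGroup ((ZhuBimodule V M ⊗[ℂ] U) ⧸ zhuTensorRel V M U))
instance : Module ℂ (ZhuTensor V M U) :=
  inferInstanceAs (Module ℂ ((ZhuBimodule V M ⊗[ℂ] U) ⧸ zhuTensorRel V M U))

variable {V M U}

/-- The pure tensor `x ⊗ u`. -/
def ZhuTensor.tmul (x : ZhuBimodule V M) (u : U) : ZhuTensor V M U :=
  (zhuTensorRel V M U).mkQ (x ⊗ₜ[ℂ] u)

variable (V M U)

lemma zhuTensorRel_le (x : ZhuAlgebra V) :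
    zhuTensorRel V M U ≤ (zhuTensorRel V M U).comap (LinearMap.rTensor U (zhuLeft V M x)) := by
  refine Submodule.span_le.2 ?_
  rintro _ ⟨v, a, u, rfl⟩
  obtain ⟨b, rfl⟩ := ZhuAlgebra.mk_surjective x
  change LinearMap.rTensor U (zhuLeft V M (ZhuAlgebra.mk b)) _ ∈ zhuTensorRel V M U
  rw [map_sub, LinearMap.rTensor_tmul, LinearMap.rTensor_tmul, zhuLeft_mk, zhuLeft_mk,
    ZhuBimodule.mk_eq.2 (zhuStar_zhuStarRight b a v)]
  exact Submodule.subset_span ⟨_, a, u, rfl⟩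

/-- The left action of `A(V)` on `A(M) ⊗_{A(V)} U`. -/
def zhuTensorAct : ZhuAlgebra V →ₗ[ℂ] Module.End ℂ (ZhuTensor V M U) where
  toFun x := (zhuTensorRel V M U).mapQ (zhuTensorRel V M U) _ (zhuTensorRel_le V M U x)
  map_add' x y := by
    refine Submodule.linearMap_qext _ ?_
    ext a b
    change (zhuTensorRel V M U).mkQ _ = (zhuTensorRel V M U).mkQ _ + (zhuTensorRel V M U).mkQ _
    simp
  map_smul' c x := by
    refine Submodule.linearMap_qext _ ?_
    ext a b
    change (zhuTensorRel V M U).mkQ _ = c • (zhuTensorRel V M U).mkQ _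
    simp only [map_smul, LinearMap.rTensor_smul, LinearMap.smul_apply]

lemma zhuTensorAct_tmul (x : ZhuAlgebra V) (y : ZhuBimodule V M) (u : U) :
    zhuTensorAct V M U x (ZhuTensor.tmul y u) = ZhuTensor.tmul (x • y) u := rfl

variable {V M U}

lemma ZhuTensor.induction {P : ZhuTensor V M U → Prop} (h0 : P 0)
    (hadd : ∀ x y, P x → P y → P (x + y)) (ht : ∀ y u, P (ZhuTensor.tmul y u))
    (x : ZhuTensor V M U) : P x := by
  obtain ⟨x, rfl⟩ := (zhuTensorRel V M U).mkQ_surjective x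
  induction x with
  | zero => exact h0
  | add x y hx hy => rw [map_add]; exact hadd _ _ hx hy
  | tmul y u => exact ht y u

variable (V M U)

/-- The left `A(V)`-module structure of `A(M) ⊗_{A(V)} U`: `x.(y ⊗ u) = (x.y) ⊗ u`. -/
instance : Module (ZhuAlgebra V) (ZhuTensor V M U) where
  smul x y := zhuTensorAct V M U x y
  one_smul y := by
    change zhuTensorAct V M U 1 y = y
    refine ZhuTensor.induction (P := fun y => zhuTensorAct V M U 1 y = y) ?_ ?_ ?_ y
    · exact map_zero _
    · intro x y hx hy; rw [map_add, hx, hy]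
    · intro y u; rw [zhuTensorAct_tmul, one_smul]
  mul_smul x x' y := by
    change zhuTensorAct V M U (x * x') y = zhuTensorAct V M U x (zhuTensorAct V M U x' y)
    refine ZhuTensor.induction (P := fun y => zhuTensorAct V M U (x * x') y
      = zhuTensorAct V M U x (zhuTensorAct V M U x' y)) ?_ ?_ ?_ y
    · simp only [map_zero]
    · intro y z hy hz; simp only [map_add, hy, hz]
    · intro y u; simp only [zhuTensorAct_tmul, mul_smul]
  smul_zero x := map_zero (zhuTensorAct V M U x)
  smul_add x y z := map_add (zhuTensorAct V M U x) y z
  add_smul x y z := LinearMap.congr_fun (map_add (zhuTensorAct V M U) x y) z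
  zero_smul x := LinearMap.congr_fun (map_zero (zhuTensorAct V M U)) x

lemma ZhuTensor.smul_tmul (x : ZhuAlgebra V) (y : ZhuBimodule V M) (u : U) :
    x • (ZhuTensor.tmul y u : ZhuTensor V M U) = ZhuTensor.tmul (x • y) u := rfl

instance : IsScalarTower ℂ (ZhuAlgebra V) (ZhuTensor V M U) where
  smul_assoc c x y := LinearMap.congr_fun (map_smul (zhuTensorAct V M U) c x) y

end ZhuTensor

/-! ### The Borcherds Lie algebra -/

section Borcherds

variable (V : Type*) [AddCommGroup V] [Module ℂ V] [VOA V]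

/-- The operator `∇ = L(-1) + d/dt` on `V ⊗ ℂ[t, t⁻¹] = (ℤ →₀ V)`, where `single n a` stands for
`a ⊗ tⁿ`. -/
def loopDeriv : (ℤ →₀ V) →ₗ[ℂ] (ℤ →₀ V) :=
  Finsupp.lsum ℂ fun n : ℤ =>
    Finsupp.lsingle n ∘ₗ VOA.Y (VOA.conf : V) 0 + n • Finsupp.lsingle (n - 1)

/-- The underlying space of the Borcherds Lie algebra `L(V) = (V ⊗ ℂ[t, t⁻¹]) / im ∇`. -/
def BorcherdsLie : Type _ := (ℤ →₀ V) ⧸ LinearMap.range (loopDeriv V)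

instance : AddCommGroup (BorcherdsLie V) :=
  inferInstanceAs (AddCommGroup ((ℤ →₀ V) ⧸ LinearMap.range (loopDeriv V)))
instance : Module ℂ (BorcherdsLie V) :=
  inferInstanceAs (Module ℂ ((ℤ →₀ V) ⧸ LinearMap.range (loopDeriv V)))

variable {V}

/-- `BorcherdsLie.mode n a` is `a_[n]`, the class of `a ⊗ tⁿ`. -/
def BorcherdsLie.mode (n : ℤ) : V →ₗ[ℂ] BorcherdsLie V :=
  (LinearMap.range (loopDeriv V)).mkQ ∘ₗ Finsupp.lsingle n

namespace BorcherdsLie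

lemma mode_derivative (n : ℤ) (a : V) :
    mode n (VOA.Y (VOA.conf : V) 0 a) = (-n : ℤ) • mode (n - 1) a := by
  rw [neg_smul, eq_neg_iff_add_eq_zero, ← map_zsmul]
  change (LinearMap.range (loopDeriv V)).mkQ _ + (LinearMap.range (loopDeriv V)).mkQ _ = 0
  rw [← map_add, Submodule.mkQ_apply, Submodule.Quotient.mk_eq_zero]
  refine ⟨Finsupp.single n a, ?_⟩
  simp [loopDeriv]

/-- A linear map out of `L(V)`. -/
def lift {W : Type*} [AddCommGroup W] [Module ℂ W] (F : ℤ → V →ₗ[ℂ] W)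
    (hF : ∀ (n : ℤ) (a : V), F n (VOA.Y (VOA.conf : V) 0 a) = (-n : ℤ) • F (n - 1) a) :
    BorcherdsLie V →ₗ[ℂ] W :=
  (LinearMap.range (loopDeriv V)).liftQ (Finsupp.lsum ℂ F) (by
    rintro _ ⟨x, rfl⟩
    rw [LinearMap.mem_ker]
    induction x using Finsupp.induction_linear with
    | zero => simp
    | add x y hx hy => rw [map_add, map_add, hx, hy, add_zero]
    | single n a =>
      rw [loopDeriv, Finsupp.lsum_single, LinearMap.add_apply, LinearMap.comp_apply,
        LinearMap.smul_apply, map_add, map_zsmul, Finsupp.lsingle_apply, Finsupp.lsingle_apply,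
        Finsupp.lsum_single, Finsupp.lsum_single, hF, neg_smul, neg_add_cancel])

lemma lift_mode {W : Type*} [AddCommGroup W] [Module ℂ W] (F : ℤ → V →ₗ[ℂ] W)
    (hF : ∀ (n : ℤ) (a : V), F n (VOA.Y (VOA.conf : V) 0 a) = (-n : ℤ) • F (n - 1) a)
    (n : ℤ) (a : V) : lift F hF (mode n a) = F n a := by
  change Finsupp.lsum ℂ F (Finsupp.single n a) = F n a
  simp

lemma induction {P : BorcherdsLie V → Prop} (h0 : P 0) (hadd : ∀ x y, P x → P y → P (x + y))
    (hm : ∀ (n p : ℤ), ∀ a ∈ VOA.grade (V := V) p, P (mode n a)) (x : BorcherdsLie V) : P x := by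
  obtain ⟨x, rfl⟩ := (LinearMap.range (loopDeriv V)).mkQ_surjective x
  induction x using Finsupp.induction_linear with
  | zero => exact h0
  | add x y hx hy => rw [map_add]; exact hadd _ _ hx hy
  | single n a =>
    refine homogeneous_induction (P := fun a => P (mode n a)) ?_ ?_ (hm n) a
    · rw [map_zero]; exact h0
    · intro a b ha hb
      rw [map_add]; exact hadd _ _ ha hb

/-- The bracket of modes, `[a_[m], b_[n]] = ∑_{j ≥ 0} (m choose j) (a(j)b)_[m+n-j]`. -/
def modeBracketFun (m n : ℤ) (a b : V) : BorcherdsLie V :=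
  ∑ᶠ j : ℕ, (Ring.choose m j : ℤ) • mode (m + n - j) (VOA.Y a j b)

lemma modeBracketFun_eq (m n : ℤ) (a b : V) (N : ℕ) (h : ∀ i : ℤ, N ≤ i → VOA.Y a i b = 0) :
    modeBracketFun m n a b
      = ∑ j ∈ Finset.range N, (Ring.choose m j : ℤ) • mode (m + n - j) (VOA.Y a j b) := by
  apply finsum_eq_range
  intro j hj
  rw [h _ (by omega), map_zero, smul_zero]

lemma exists_trunc₀ (a b : V) : ∃ N : ℕ, ∀ n : ℤ, N ≤ n → VOA.Y a n b = 0 := by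
  obtain ⟨N, hN⟩ := exists_trunc (M := V) a b 0
  exact ⟨N, fun n hn => hN n (by omega)⟩

/-- The bracket of modes as a bilinear map. -/
def modeBracket (m n : ℤ) : V →ₗ[ℂ] V →ₗ[ℂ] BorcherdsLie V :=
  LinearMap.mk₂ ℂ (modeBracketFun m n)
    (fun a a' u => by
      obtain ⟨N, hN⟩ := exists_trunc₀ a u
      obtain ⟨N', hN'⟩ := exists_trunc₀ a' u
      rw [modeBracketFun_eq m n a u (max N N') (fun n hn => hN n (by push_cast at hn; omega)),
        modeBracketFun_eq m n a' u (max N N') (fun n hn => hN' n (by push_cast at hn; omega)),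
        modeBracketFun_eq m n (a + a') u (max N N') (fun n hn => by
          rw [map_add, Pi.add_apply, LinearMap.add_apply, hN n (by push_cast at hn; omega),
            hN' n (by push_cast at hn; omega), add_zero]), ← Finset.sum_add_distrib]
      simp)
    (fun c a u => by
      obtain ⟨N, hN⟩ := exists_trunc₀ a u
      rw [modeBracketFun_eq m n a u N hN, modeBracketFun_eq m n (c • a) u N (fun n hn => by
          rw [map_smul, Pi.smul_apply, LinearMap.smul_apply, hN n hn, smul_zero]),
        Finset.smul_sum]
      exact Finset.sum_congr rfl fun j _ => by
        rw [map_smul, Pi.smul_apply, LinearMap.smul_apply, map_smul, smul_comm])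
    (fun a u u' => by
      obtain ⟨N, hN⟩ := exists_trunc₀ a u
      obtain ⟨N', hN'⟩ := exists_trunc₀ a u'
      rw [modeBracketFun_eq m n a u (max N N') (fun n hn => hN n (by push_cast at hn; omega)),
        modeBracketFun_eq m n a u' (max N N') (fun n hn => hN' n (by push_cast at hn; omega)),
        modeBracketFun_eq m n a (u + u') (max N N') (fun n hn => by
          rw [map_add, hN n (by push_cast at hn; omega),
            hN' n (by push_cast at hn; omega), add_zero]), ← Finset.sum_add_distrib]
      simp)
    (fun c a u => by
      obtain ⟨N, hN⟩ := exists_trunc₀ a u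
      rw [modeBracketFun_eq m n a u N hN, modeBracketFun_eq m n a (c • u) N (fun n hn => by
          rw [map_smul, hN n hn, smul_zero]),
        Finset.smul_sum]
      exact Finset.sum_congr rfl fun j _ => by rw [map_smul, map_smul, smul_comm])

/-- The linear map `a ↦ a_[wt a + k]`. -/
def shift (k : ℤ) : V →ₗ[ℂ] BorcherdsLie V := wtLift fun r => mode (r + k)

lemma shift_of_mem (k : ℤ) {r : ℤ} {c : V} (hc : c ∈ VOA.grade (V := V) r) :
    shift k c = mode (r + k) c := wtLift_of_mem _ hc

lemma shift_derivative (k : ℤ) (r : ℤ) (c : V) (hc : c ∈ VOA.grade (V := V) r) :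
    shift k (VOA.Y (VOA.conf : V) 0 c) = (-(1 + k) - r) • shift k c := by
  rw [shift_of_mem k (derivative_mem_grade hc), shift_of_mem k hc, mode_derivative,
    show r + 1 + k - 1 = r + k by ring]
  congr 1; ring

lemma modeBracket_of_mem (m n : ℤ) {p q : ℤ} {a b : V} (ha : a ∈ VOA.grade (V := V) p)
    (hb : b ∈ VOA.grade (V := V) q) :
    modeBracket m n a b = shift (m + n + 1 - p - q) (modeSum m 0 a b) := by
  obtain ⟨N, hN⟩ := exists_trunc₀ a b
  have h := modeBracketFun_eq m n a b N hN
  change modeBracketFun m n a b = _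
  rw [h, shift, wtLift_modeSum _ ha hb m (I := N) (fun i hi => hN i (by omega))]
  refine Finset.sum_congr rfl fun j _ => ?_
  rw [zero_add, show p + q - 0 - 1 - (j : ℤ) + (m + n + 1 - p - q) = m + n - j by ring]

lemma modeBracket_skew (m n : ℤ) (a b : V) : modeBracket m n a b = -modeBracket n m b a := by
  refine homogeneous_induction (P := fun a => modeBracket m n a b = -modeBracket n m b a)
    ?_ ?_ ?_ a
  · simp
  · intro a a' ha ha'
    rw [map_add, LinearMap.add_apply, ha, ha', map_add]; abel
  intro p a ha
  refine homogeneous_induction (P := fun b => modeBracket m n a b = -modeBracket n m b a)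
    ?_ ?_ ?_ b
  · simp
  · intro b b' hb hb'
    rw [map_add, hb, hb', map_add, LinearMap.add_apply]; abel
  intro q b hb
  rw [modeBracket_of_mem m n ha hb, modeBracket_of_mem n m hb ha]
  have := skew_modeSum (shift (m + n + 1 - p - q)) _ (shift_derivative (m + n + 1 - p - q))
    hb ha m 0
  rw [this, Int.negOnePow_zero, Units.val_one, neg_smul, one_smul,
    show q + p - -(1 + (m + n + 1 - p - q)) - 0 - 2 - m = n by ring,
    show n + m + 1 - q - p = m + n + 1 - p - q by ring]

lemma modeBracket_derivative (m n : ℤ) (a b : V) :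
    modeBracket m n (VOA.Y (VOA.conf : V) 0 a) b = (-m : ℤ) • modeBracket (m - 1) n a b := by
  refine homogeneous_induction (P := fun a => modeBracket m n (VOA.Y (VOA.conf : V) 0 a) b
    = (-m : ℤ) • modeBracket (m - 1) n a b) ?_ ?_ ?_ a
  · simp
  · intro a a' ha ha'
    rw [map_add, map_add, LinearMap.add_apply, ha, ha', map_add, LinearMap.add_apply, smul_add]
  intro p a ha
  refine homogeneous_induction (P := fun b => modeBracket m n (VOA.Y (VOA.conf : V) 0 a) b
    = (-m : ℤ) • modeBracket (m - 1) n a b) ?_ ?_ ?_ b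
  · simp
  · intro b b' hb hb'
    rw [map_add, map_add, hb, hb', smul_add]
  intro q b hb
  rw [modeBracket_of_mem m n (derivative_mem_grade ha) hb, modeBracket_of_mem (m - 1) n ha hb,
    modeSum_derivative, neg_zero, zero_smul, zero_sub, ← neg_smul, map_zsmul,
    show m + n + 1 - (p + 1) - q = m - 1 + n + 1 - p - q by ring]

/-- The bracket of `L(V)` as a bilinear map. -/
def bracket : BorcherdsLie V →ₗ[ℂ] BorcherdsLie V →ₗ[ℂ] BorcherdsLie V :=
  lift (fun m => LinearMap.flip (lift (fun n => (modeBracket m n).flip) (fun n b => by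
      refine LinearMap.ext fun a => ?_
      change modeBracket m n a _ = (-n : ℤ) • modeBracket m (n - 1) a b
      rw [modeBracket_skew, modeBracket_derivative, modeBracket_skew m (n - 1), smul_neg])))
    (fun m a => by
      refine LinearMap.ext fun y => ?_
      refine induction (P := fun y => _ = _) ?_ ?_ ?_ y
      · simp only [map_zero]
      · intro x y hx hy
        rw [map_add, hx, hy, map_add]
      · intro n q b _
        rw [LinearMap.smul_apply, LinearMap.flip_apply, LinearMap.flip_apply, lift_mode, lift_mode]
        exact modeBracket_derivative m n a b)

lemma bracket_mode (m n : ℤ) (a b : V) : bracket (mode m a) (mode n b) = modeBracket m n a b := by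
  rw [bracket, lift_mode, LinearMap.flip_apply, lift_mode, LinearMap.flip_apply]

lemma bracket_mode_of_mem (m n : ℤ) {p q : ℤ} {a b : V} (ha : a ∈ VOA.grade (V := V) p)
    (hb : b ∈ VOA.grade (V := V) q) :
    bracket (mode m a) (mode n b) = shift (m + n + 1 - p - q) (modeSum m 0 a b) := by
  rw [bracket_mode, modeBracket_of_mem m n ha hb]

lemma bracket_mode_shift (m k : ℤ) {p : ℤ} {a : V} (ha : a ∈ VOA.grade (V := V) p) (x : V) :
    bracket (mode m a) (shift k x) = shift (m + k + 1 - p) (modeSum m 0 a x) := by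
  refine homogeneous_induction (P := fun x => bracket (mode m a) (shift k x)
    = shift (m + k + 1 - p) (modeSum m 0 a x)) ?_ ?_ ?_ x
  · simp
  · intro x y hx hy
    simp only [map_add, hx, hy]
  intro s x hx
  rw [shift_of_mem k hx, bracket_mode_of_mem m (s + k) ha hx,
    show m + (s + k) + 1 - p - s = m + k + 1 - p by ring]

lemma bracket_shift_mode (k n : ℤ) {q : ℤ} {b : V} (hb : b ∈ VOA.grade (V := V) q) (x : V) :
    bracket (shift k x) (mode n b)
      = shift (k + n + 1 - q) (wtLift (fun s => modeSum (s + k) 0) x b) := by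
  refine homogeneous_induction (P := fun x => bracket (shift k x) (mode n b)
      = shift (k + n + 1 - q) (wtLift (fun s => modeSum (s + k) 0) x b)) ?_ ?_ ?_ x
  · simp
  · intro x y hx hy
    simp only [map_add, LinearMap.add_apply, hx, hy]
  intro s x hx
  rw [shift_of_mem k hx, bracket_mode_of_mem (s + k) n hx hb, wtLift_of_mem _ hx,
    show s + k + n + 1 - s - q = k + n + 1 - q by ring]

lemma bracket_skew (x y : BorcherdsLie V) : bracket x y = -bracket y x := by
  refine induction (P := fun x => bracket x y = -bracket y x) ?_ ?_ ?_ x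
  · simp
  · intro x x' hx hx'
    rw [map_add, LinearMap.add_apply, hx, hx', map_add]; abel
  intro m p a ha
  refine induction (P := fun y => bracket (mode m a) y = -bracket y (mode m a)) ?_ ?_ ?_ y
  · simp
  · intro y y' hy hy'
    rw [map_add, hy, hy', map_add, LinearMap.add_apply]; abel
  intro n q b hb
  rw [bracket_mode, bracket_mode, modeBracket_skew]

lemma bracket_leibniz (x y z : BorcherdsLie V) :
    bracket x (bracket y z) = bracket (bracket x y) z + bracket y (bracket x z) := by
  refine induction (P := fun x => bracket x (bracket y z)
    = bracket (bracket x y) z + bracket y (bracket x z)) ?_ ?_ ?_ x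
  · simp
  · intro x x' hx hx'
    simp only [map_add, LinearMap.add_apply, hx, hx']; abel
  intro m p a ha
  refine induction (P := fun y => bracket (mode m a) (bracket y z)
    = bracket (bracket (mode m a) y) z + bracket y (bracket (mode m a) z)) ?_ ?_ ?_ y
  · simp
  · intro y y' hy hy'
    simp only [map_add, LinearMap.add_apply, hy, hy']; abel
  intro n q b hb
  refine induction (P := fun z => bracket (mode m a) (bracket (mode n b) z)
    = bracket (bracket (mode m a) (mode n b)) z + bracket (mode n b) (bracket (mode m a) z))
    ?_ ?_ ?_ z
  · simp
  · intro z z' hz hz'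
    simp only [map_add, hz, hz']; abel
  intro k r c hc
  rw [bracket_mode_of_mem n k hb hc, bracket_mode_of_mem m n ha hb, bracket_mode_of_mem m k ha hc,
    bracket_mode_shift _ _ ha, bracket_mode_shift _ _ hb, bracket_shift_mode _ _ hc,
    show m + (n + k + 1 - q - r) + 1 - p = m + n + k + 2 - p - q - r by ring,
    show n + (m + k + 1 - p - r) + 1 - q = m + n + k + 2 - p - q - r by ring,
    show m + n + 1 - p - q + k + 1 - r = m + n + k + 2 - p - q - r by ring,
    ← sub_eq_iff_eq_add, ← map_sub]
  congr 1
  have h := modeSum_commutator_wtLift ha hb c m n 0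
  rw [h]
  congr 3
  funext w
  rw [show m + n + w - p - q + 1 = w + (m + n + 1 - p - q) by ring]

end BorcherdsLie

open BorcherdsLie

instance : LieRing (BorcherdsLie V) where
  __ := (inferInstance : AddCommGroup (BorcherdsLie V))
  bracket x y := bracket x y
  add_lie x y z := by
    change bracket (x + y) z = bracket x z + bracket y z
    rw [map_add, LinearMap.add_apply]
  lie_add x y z := map_add (bracket x) y z
  lie_self x := by
    have h : bracket x x + bracket x x = 0 := eq_neg_iff_add_eq_zero.1 (bracket_skew x x)
    rw [← two_smul ℂ] at h
    exact (smul_eq_zero.1 h).resolve_left two_ne_zero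
  leibniz_lie x y z := bracket_leibniz x y z

instance : LieAlgebra ℂ (BorcherdsLie V) where
  lie_smul c x y := map_smul (bracket x) c y

lemma BorcherdsLie.lie_mode (m n : ℤ) (a b : V) :
    ⁅mode m a, mode n b⁆
      = ∑ᶠ j : ℕ, (Ring.choose m j : ℤ) • mode (m + n - j) (VOA.Y a j b) :=
  bracket_mode m n a b

lemma BorcherdsLie.lie_mode_range (m n : ℤ) (a b : V) (N : ℕ)
    (h : ∀ i : ℤ, N ≤ i → VOA.Y a i b = 0) :
    ⁅mode m a, mode n b⁆
      = ∑ j ∈ Finset.range N, (Ring.choose m j : ℤ) • mode (m + n - j) (VOA.Y a j b) :=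
  (lie_mode m n a b).trans (modeBracketFun_eq m n a b N h)

lemma BorcherdsLie.shift_mem (x : V) : shift (-1) x ∈ Submodule.span ℂ
    {y : BorcherdsLie V | ∃ (p : ℤ) (a : V), a ∈ VOA.grade (V := V) p ∧ y = mode (p - 1) a} := by
  refine homogeneous_induction (P := fun x => shift (-1) x ∈ Submodule.span ℂ
    {y : BorcherdsLie V | ∃ (p : ℤ) (a : V), a ∈ VOA.grade (V := V) p ∧ y = mode (p - 1) a})
    ?_ ?_ ?_ x
  · simp
  · intro x y hx hy
    rw [map_add]; exact Submodule.add_mem _ hx hy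
  intro p a ha
  refine Submodule.subset_span ⟨p, a, ha, ?_⟩
  rw [shift_of_mem _ ha, sub_eq_add_neg]

variable (V)

/-- The degree zero subalgebra `L(V)_0 = span {a_[wt a - 1]}`. -/
def BorcherdsLieZero : LieSubalgebra ℂ (BorcherdsLie V) where
  __ := Submodule.span ℂ
    {y : BorcherdsLie V | ∃ (p : ℤ) (a : V), a ∈ VOA.grade (V := V) p ∧ y = mode (p - 1) a}
  lie_mem' {x y} hx hy := by
    change x ∈ Submodule.span ℂ _ at hx
    change y ∈ Submodule.span ℂ _ at hy
    change bracket x y ∈ Submodule.span ℂ _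
    induction hx using Submodule.span_induction with
    | zero => simp
    | add x x' _ _ hx hx' => rw [map_add, LinearMap.add_apply]; exact Submodule.add_mem _ hx hx'
    | smul c x _ hx => rw [map_smul, LinearMap.smul_apply]; exact Submodule.smul_mem _ c hx
    | mem x hx =>
      obtain ⟨p, a, ha, rfl⟩ := hx
      induction hy using Submodule.span_induction with
      | zero => simp
      | add y y' _ _ hy hy' => rw [map_add]; exact Submodule.add_mem _ hy hy'
      | smul c y _ hy => rw [map_smul]; exact Submodule.smul_mem _ c hy
      | mem y hy =>
        obtain ⟨q, b, hb, rfl⟩ := hy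
        rw [bracket_mode_of_mem _ _ ha hb, show p - 1 + (q - 1) + 1 - p - q = -1 by ring]
        exact shift_mem _

variable {V}

/-- `a_[wt a - 1] ∈ L(V)_0`, as a linear function of `a`. -/
def BorcherdsLieZero.of : V →ₗ[ℂ] BorcherdsLieZero V :=
  (shift (-1)).codRestrict (BorcherdsLieZero V).toSubmodule shift_mem

lemma BorcherdsLieZero.coe_of {p : ℤ} {a : V} (ha : a ∈ VOA.grade (V := V) p) :
    (BorcherdsLieZero.of a : BorcherdsLie V) = mode (p - 1) a := by
  change shift (-1) a = _
  rw [shift_of_mem _ ha, sub_eq_add_neg]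

lemma BorcherdsLieZero.of_surjective :
    Function.Surjective (BorcherdsLieZero.of : V → BorcherdsLieZero V) := by
  rintro ⟨x, hx⟩
  suffices ∃ a : V, shift (-1) a = x by
    obtain ⟨a, ha⟩ := this
    exact ⟨a, Subtype.ext ha⟩
  change x ∈ Submodule.span ℂ _ at hx
  have : Submodule.span ℂ {y : BorcherdsLie V |
      ∃ (p : ℤ) (a : V), a ∈ VOA.grade (V := V) p ∧ y = mode (p - 1) a}
      ≤ LinearMap.range (shift (V := V) (-1)) := by
    refine Submodule.span_le.2 ?_
    rintro _ ⟨p, a, ha, rfl⟩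
    exact ⟨a, by rw [shift_of_mem _ ha, sub_eq_add_neg]⟩
  exact this hx

/-- The linear map `L(V) → A(V)` with `a_[wt a - 1] ↦ [a]` that is zero on `a_[n]` if
`n ≠ wt a - 1`. -/
def BorcherdsLie.toZhuLinear : BorcherdsLie V →ₗ[ℂ] ZhuAlgebra V :=
  lift (fun n => wtLift fun r => if r = n + 1 then ZhuAlgebra.mk else 0) (fun n a => by
    refine homogeneous_induction (P := fun a =>
      (wtLift fun r => if r = n + 1 then ZhuAlgebra.mk else 0) (VOA.Y (VOA.conf : V) 0 a)
        = (-n : ℤ) • (wtLift fun r => if r = n - 1 + 1 then ZhuAlgebra.mk else 0) a) ?_ ?_ ?_ a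
    · simp only [map_zero, smul_zero]
    · intro a b ha hb
      rw [map_add, map_add, ha, hb, map_add, smul_add]
    · intro r a ha
      rw [wtLift_of_mem _ (derivative_mem_grade ha), wtLift_of_mem _ ha]
      by_cases h : r = n
      · subst h
        rw [if_pos rfl, if_pos (by ring), neg_smul, eq_neg_iff_add_eq_zero, ← map_zsmul, ← map_add]
        exact ZhuAlgebra.mk_eq_zero.2 (derivative_add_weight_mem ha)
      · rw [if_neg (by omega), if_neg (by omega)]; simp)

lemma BorcherdsLie.toZhuLinear_shift (x : V) :
    toZhuLinear (shift (-1) x) = ZhuAlgebra.mk x := by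
  refine homogeneous_induction (P := fun x => toZhuLinear (shift (-1) x) = ZhuAlgebra.mk x)
    ?_ ?_ ?_ x
  · simp
  · intro x y hx hy
    simp only [map_add, hx, hy]
  intro p a ha
  rw [shift_of_mem _ ha, toZhuLinear, lift_mode, wtLift_of_mem _ ha, if_pos (by ring)]

/-- The map `L(V)_0 → A(V)`, `a_[wt a - 1] ↦ [a]`.  It is a homomorphism of Lie algebras for the
commutator bracket of `A(V)`. -/
def BorcherdsLieZero.toZhu : BorcherdsLieZero V →ₗ[ℂ] ZhuAlgebra V :=
  toZhuLinear ∘ₗ (BorcherdsLieZero V).toSubmodule.subtype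

lemma BorcherdsLieZero.toZhu_lie (x y : BorcherdsLieZero V) :
    toZhu ⁅x, y⁆ = toZhu x * toZhu y - toZhu y * toZhu x := by
  obtain ⟨a, rfl⟩ := BorcherdsLieZero.of_surjective x
  obtain ⟨b, rfl⟩ := BorcherdsLieZero.of_surjective y
  change toZhuLinear (bracket (shift (-1) a) (shift (-1) b))
    = toZhuLinear (shift (-1) a) * toZhuLinear (shift (-1) b)
      - toZhuLinear (shift (-1) b) * toZhuLinear (shift (-1) a)
  rw [toZhuLinear_shift, toZhuLinear_shift]
  refine homogeneous_induction (P := fun a => toZhuLinear (bracket (shift (-1) a) (shift (-1) b))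
    = ZhuAlgebra.mk a * ZhuAlgebra.mk b - ZhuAlgebra.mk b * ZhuAlgebra.mk a) ?_ ?_ ?_ a
  · simp
  · intro a a' ha ha'
    simp only [map_add, LinearMap.add_apply, add_mul, mul_add, ha, ha']; abel
  intro p a ha
  refine homogeneous_induction (P := fun b => toZhuLinear (bracket (shift (-1) a) (shift (-1) b))
    = ZhuAlgebra.mk a * ZhuAlgebra.mk b - ZhuAlgebra.mk b * ZhuAlgebra.mk a) ?_ ?_ ?_ b
  · simp
  · intro b b' hb hb'
    simp only [map_add, add_mul, mul_add, hb, hb']; abel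
  intro q b hb
  rw [shift_of_mem _ ha, bracket_mode_shift _ _ ha, show p + -1 + -1 + 1 - p = -1 by ring,
    toZhuLinear_shift, ZhuAlgebra.mk_mul, ZhuAlgebra.mk_mul, ← map_sub, ← sub_eq_add_neg,
    eq_comm, ZhuAlgebra.mk_eq]
  exact zhuStar_commutator ha hb

lemma BorcherdsLieZero.toZhu_of (a : V) :
    BorcherdsLieZero.toZhu (BorcherdsLieZero.of a) = ZhuAlgebra.mk a :=
  toZhuLinear_shift a

end Borcherds

section BottomLie

variable (V : Type*) [AddCommGroup V] [Module ℂ V] [VOA V]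
  (M : Type*) [AddCommGroup M] [Module ℂ M] [AdmissibleModule V M]

/-- The bottom degree `M(0)` as a module over `L(V)_0`: `a_[wt a - 1]` acts as `[a]`, that is, as
the zero mode `o(a)`. -/
instance : LieRingModule (BorcherdsLieZero V) (Bottom V M) where
  bracket x w := BorcherdsLieZero.toZhu x • w
  add_lie x y w := by
    change BorcherdsLieZero.toZhu (x + y) • w
      = BorcherdsLieZero.toZhu x • w + BorcherdsLieZero.toZhu y • w
    rw [map_add, add_smul]
  lie_add x w w' := smul_add (BorcherdsLieZero.toZhu x) w w'
  leibniz_lie x y w := by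
    change BorcherdsLieZero.toZhu x • BorcherdsLieZero.toZhu y • w
      = BorcherdsLieZero.toZhu ⁅x, y⁆ • w + BorcherdsLieZero.toZhu y • BorcherdsLieZero.toZhu x • w
    rw [BorcherdsLieZero.toZhu_lie, sub_smul, mul_smul, mul_smul,
      sub_add_cancel]

lemma Bottom.lie_def (x : BorcherdsLieZero V) (w : Bottom V M) :
    ⁅x, w⁆ = BorcherdsLieZero.toZhu x • w := rfl

instance : LieModule ℂ (BorcherdsLieZero V) (Bottom V M) where
  smul_lie c x w := by
    rw [Bottom.lie_def, Bottom.lie_def, map_smul, smul_assoc]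
  lie_smul c x w := by
    rw [Bottom.lie_def, Bottom.lie_def, smul_comm]

end BottomLie

/-! ### The contracted tensor product -/

section Rho

variable {V : Type*} [AddCommGroup V] [Module ℂ V] [VOA V]

open BorcherdsLie

lemma BorcherdsLie.lift_lie {W : Type*} [AddCommGroup W] [Module ℂ W]
    (F : ℤ → V →ₗ[ℂ] Module.End ℂ W)
    (hF : ∀ (n : ℤ) (a : V), F n (VOA.Y (VOA.conf : V) 0 a) = (-n : ℤ) • F (n - 1) a)
    (hc : ∀ (m n : ℤ) (a b : V) (u : W), ∃ I : ℕ, F m a (F n b u) - F n b (F m a u)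
      = ∑ i ∈ Finset.range I, (Ring.choose m i : ℤ) • F (m + n - i) (VOA.Y a i b) u ∧
      ∀ i : ℤ, I ≤ i → VOA.Y a i b = 0) (x y : BorcherdsLie V) (u : W) :
    lift F hF ⁅x, y⁆ u = lift F hF x (lift F hF y u) - lift F hF y (lift F hF x u) := by
  refine induction (P := fun x => lift F hF ⁅x, y⁆ u
    = lift F hF x (lift F hF y u) - lift F hF y (lift F hF x u)) ?_ ?_ ?_ x
  · simp
  · intro x x' hx hx'
    simp only [add_lie, map_add, LinearMap.add_apply, hx, hx']; abel
  intro m p a _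
  refine induction (P := fun y => lift F hF ⁅mode m a, y⁆ u
    = lift F hF (mode m a) (lift F hF y u) - lift F hF y (lift F hF (mode m a) u)) ?_ ?_ ?_ y
  · simp
  · intro y y' hy hy'
    simp only [lie_add, map_add, LinearMap.add_apply, hy, hy']; abel
  intro n q b _
  obtain ⟨I, h, h3⟩ := hc m n a b u
  rw [lie_mode_range m n a b I h3, lift_mode, lift_mode, h, map_sum, LinearMap.sum_apply]
  refine Finset.sum_congr rfl fun i _ => ?_
  rw [map_zsmul, LinearMap.smul_apply, lift_mode]

variable {M : Type*} [AddCommGroup M] [Module ℂ M] [WeakModule V M]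

lemma mode_commutator (a b : V) (u : M) (m n : ℤ) :
    ∃ I : ℕ, WeakModule.Y a m (WeakModule.Y b n u) - WeakModule.Y b n (WeakModule.Y a m u)
      = ∑ i ∈ Finset.range I, (Ring.choose m i : ℤ) •
          WeakModule.Y (VOA.Y a i b) (m + n - i) u ∧
      ∀ i : ℤ, I ≤ i → VOA.Y a i b = 0 := by
  obtain ⟨I₁, h₁⟩ := exists_trunc b u n
  obtain ⟨I₂, h₂⟩ := exists_trunc a u m
  obtain ⟨I₃, h₃⟩ := exists_trunc₀ a b
  obtain ⟨J, hI₁, hI₂, hI₃⟩ : ∃ J, I₁ ≤ J + 1 ∧ I₂ ≤ J + 1 ∧ I₃ ≤ J + 1 :=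
    ⟨max I₁ (max I₂ I₃), by omega, by omega, by omega⟩
  refine ⟨J + 1, ?_, fun i hi => h₃ i (by push_cast at hi; omega)⟩
  have h := borcherds_range a b u 0 m n (J + 1) (fun i hi => h₁ i (by push_cast at hi; omega))
    (fun i hi => h₂ i (by push_cast at hi; omega)) (fun i hi => h₃ i (by push_cast at hi; omega))
  simp only [zero_add] at h
  rw [← h, Finset.sum_range_succ', Finset.sum_range_succ', Finset.sum_eq_zero (fun i _ => by
      rw [Ring.choose_zero_succ, mul_zero, zero_smul]),
    Finset.sum_eq_zero (fun i _ => by rw [Ring.choose_zero_succ, mul_zero, zero_smul])]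
  simp

variable (V M)

/-- The action of `L(V)` on `M` placed at the point `0`: `a_[n]` acts as `a(n)`. -/
def actZero : BorcherdsLie V →ₗ[ℂ] Module.End ℂ M :=
  lift (fun n => LinearMap.proj n ∘ₗ WeakModule.Y) fun n a => WeakModule.derivative a n

/-- The action of `L(V)` on `M` placed at the point `1`: `a_[n]` acts as
`∑_{j ≥ 0} (n choose j) a(j)`. -/
def actOne : BorcherdsLie V →ₗ[ℂ] Module.End ℂ M :=
  lift (fun n => modeSum n 0) fun n a => LinearMap.ext fun u => by
    rw [modeSum_derivative, neg_zero, zero_smul, zero_sub, ← neg_smul, LinearMap.smul_apply]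

variable {V M}

lemma actZero_mode (n : ℤ) (a : V) (u : M) : actZero V M (mode n a) u = WeakModule.Y a n u := by
  exact LinearMap.congr_fun (lift_mode (fun n => LinearMap.proj n ∘ₗ WeakModule.Y)
    (fun n a => WeakModule.derivative a n) n a) u

lemma actOne_mode (n : ℤ) (a : V) (u : M) : actOne V M (mode n a) u = modeSum n 0 a u := by
  rw [actOne, lift_mode]

lemma actZero_lie (x y : BorcherdsLie V) (u : M) : actZero V M ⁅x, y⁆ u
    = actZero V M x (actZero V M y u) - actZero V M y (actZero V M x u) :=
  lift_lie _ _ (fun m n a b u => mode_commutator a b u m n) x y u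

lemma actOne_lie (x y : BorcherdsLie V) (u : M) : actOne V M ⁅x, y⁆ u
    = actOne V M x (actOne V M y u) - actOne V M y (actOne V M x u) :=
  lift_lie _ _ (fun m n a b u => modeSum_commutator a b u m n 0) x y u

/-- `ρ₁(a ⊗ zⁿ/(z-1)ᵐ) v = ∑_{j ≥ 0} (n choose j) a(j-m) v`, the residue at `z = 1` of
`Y_M(a, z-1) v · zⁿ/(z-1)ᵐ`. -/
def rhoOne (a : V) (n m : ℤ) (v : M) : M := modeSum n (-m) a v

/-- `ρ₀(a ⊗ zⁿ/(z-1)ᵐ) v = ∑_{j ≥ 0} (-m choose j) (-1)^(-m-j) a(n+j) v`, the residue at `z = 0`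
of `Y_M(a, z) v · zⁿ/(z-1)ᵐ`. -/
def rhoZero (a : V) (n m : ℤ) (v : M) : M :=
  ∑ᶠ j : ℕ, (((-m - j).negOnePow : ℤ) * Ring.choose (-m) j) • WeakModule.Y a (n + j) v

lemma rhoZero_eq (a : V) (n m : ℤ) (v : M) (N : ℕ)
    (h : ∀ i : ℤ, n + N ≤ i → WeakModule.Y a i v = 0) :
    rhoZero a n m v = ∑ j ∈ Finset.range N,
      (((-m - j).negOnePow : ℤ) * Ring.choose (-m) j) • WeakModule.Y a (n + j) v := by
  apply finsum_eq_range
  intro j hj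
  rw [h _ (by omega), smul_zero]

/-- The commutator of `c(r)` with `ρ₀(a ⊗ zⁿ/(z-1)ᵐ)`. -/
lemma rhoZero_commutator (c a : V) (r n m : ℤ) (v : M) :
    ∃ I : ℕ, ∀ J : ℕ, I ≤ J → WeakModule.Y c r (rhoZero a n m v)
        - rhoZero a n m (WeakModule.Y c r v)
      = ∑ i ∈ Finset.range J, (Ring.choose r i : ℤ) • rhoZero (VOA.Y c i a) (r + n - i) m v := by
  obtain ⟨N₁, h₁⟩ := exists_trunc a v n
  obtain ⟨N₂, h₂⟩ := exists_trunc a (WeakModule.Y c r v) n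
  obtain ⟨I, hI⟩ := exists_trunc₀ c a
  refine ⟨I, fun J hJ => ?_⟩
  obtain ⟨N₃, h₃⟩ : ∃ N₃ : ℕ, ∀ i ∈ Finset.range J, ∀ k : ℤ, r + n - i + N₃ ≤ k →
      WeakModule.Y (VOA.Y c i a) k v = 0 := by
    choose f hf using fun i : ℕ => exists_trunc (VOA.Y c i a) v (r + n - i)
    refine ⟨(Finset.range J).sup f, fun i hi k hk => hf i k ?_⟩
    have : f i ≤ (Finset.range J).sup f := Finset.le_sup hi
    omega
  obtain ⟨N, hN₁, hN₂, hN₃⟩ : ∃ N, N₁ ≤ N ∧ N₂ ≤ N ∧ N₃ ≤ N :=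
    ⟨max N₁ (max N₂ N₃), by omega, by omega, by omega⟩
  have e₀ : ∑ i ∈ Finset.range J, (Ring.choose r i : ℤ) • rhoZero (VOA.Y c i a) (r + n - i) m v
      = ∑ i ∈ Finset.range J, (Ring.choose r i : ℤ) • ∑ j ∈ Finset.range N,
        (((-m - j).negOnePow : ℤ) * Ring.choose (-m) j) •
          WeakModule.Y (VOA.Y c i a) (r + n - i + j) v :=
    Finset.sum_congr rfl fun i hi => by
      rw [rhoZero_eq _ (r + n - i) m v N (fun k hk => h₃ i hi k (by omega))]
  rw [e₀, rhoZero_eq a n m v N (fun i hi => h₁ i (by omega)),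
    rhoZero_eq a n m _ N (fun i hi => h₂ i (by omega)), map_sum, ← Finset.sum_sub_distrib]
  simp only [Finset.smul_sum]
  rw [Finset.sum_comm]
  refine Finset.sum_congr rfl fun j _ => ?_
  rw [map_zsmul, ← smul_sub]
  obtain ⟨I', h, h'⟩ := mode_commutator c a v r (n + j)
  have e : ∑ i ∈ Finset.range I', (Ring.choose r i : ℤ) •
        WeakModule.Y (VOA.Y c i a) (r + (n + j) - i) v
      = ∑ i ∈ Finset.range J, (Ring.choose r i : ℤ) •
        WeakModule.Y (VOA.Y c i a) (r + (n + j) - i) v := by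
    rw [← finsum_eq_range (fun i : ℕ => (Ring.choose r i : ℤ) •
        WeakModule.Y (VOA.Y c i a) (r + (n + j) - i) v) I' (fun i hi => by
          rw [h' _ (by omega), map_zero]; simp),
      ← finsum_eq_range (fun i : ℕ => (Ring.choose r i : ℤ) •
        WeakModule.Y (VOA.Y c i a) (r + (n + j) - i) v) J (fun i hi => by
          rw [hI _ (by omega), map_zero]; simp)]
  rw [h, e, Finset.smul_sum]
  refine Finset.sum_congr rfl fun i _ => ?_
  rw [smul_comm, show r + (n + (j : ℤ)) - i = r + n - i + j by ring]

lemma rhoOne_commutator (c a : V) (r n m : ℤ) (v : M) :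
    ∃ I : ℕ, ∀ J : ℕ, I ≤ J → modeSum r 0 c (rhoOne a n m v) - rhoOne a n m (modeSum r 0 c v)
      = ∑ i ∈ Finset.range J, (Ring.choose r i : ℤ) • rhoOne (VOA.Y c i a) (r + n - i) m v := by
  obtain ⟨I, h, h'⟩ := modeSum_commutator c a v r n (-m)
  refine ⟨I, fun J hJ => ?_⟩
  have z : ∀ i : ℕ, I ≤ i → (Ring.choose r i : ℤ) •
      modeSum (r + n - i) (-m) (VOA.Y c i a) v = 0 := fun i hi => by
    rw [h' _ (by omega), map_zero]; simp
  change modeSum r 0 c (modeSum n (-m) a v) - modeSum n (-m) a (modeSum r 0 c v)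
    = ∑ i ∈ Finset.range J, (Ring.choose r i : ℤ) • modeSum (r + n - i) (-m) (VOA.Y c i a) v
  rw [h, ← finsum_eq_range _ I z, ← finsum_eq_range _ J fun i hi => z i (by omega)]

end Rho

section Odot

open BorcherdsLie

variable (V : Type*) [AddCommGroup V] [Module ℂ V] [VOA V]
  (M₁ : Type*) [AddCommGroup M₁] [Module ℂ M₁] [WeakModule V M₁]
  (M₂ : Type*) [AddCommGroup M₂] [Module ℂ M₂] [WeakModule V M₂]

/-- The action of `L(V)` on `M₁ ⊗ M₂`, with `M₁` placed at `1` and `M₂` at `0`: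
`x.(v₁ ⊗ v₂) = ρ₁(x) v₁ ⊗ v₂ + v₁ ⊗ ρ₀(x) v₂`. -/
def tensorAct : BorcherdsLie V →ₗ[ℂ] Module.End ℂ (M₁ ⊗[ℂ] M₂) :=
  LinearMap.rTensorHom M₂ ∘ₗ actOne V M₁ + LinearMap.lTensorHom M₁ ∘ₗ actZero V M₂

/-- The subspace `𝓛_{<0}.(M₁ ⊗ M₂)`, where `𝓛_{<0}` is spanned by the elements `a ⊗ zⁿ/(z-1)ᵐ` with
`n - m < wt a - 1`, and `X.(v₁ ⊗ v₂) = ρ₁(X) v₁ ⊗ v₂ + v₁ ⊗ ρ₀(X) v₂`. -/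
def odotRel : Submodule ℂ (M₁ ⊗[ℂ] M₂) :=
  Submodule.span ℂ {x | ∃ (p : ℤ) (a : V) (n m : ℤ) (v₁ : M₁) (v₂ : M₂),
    a ∈ VOA.grade (V := V) p ∧ n - m < p - 1 ∧
      x = rhoOne a n m v₁ ⊗ₜ[ℂ] v₂ + v₁ ⊗ₜ[ℂ] rhoZero a n m v₂}

/-- The contracted tensor product `M₁ ⊙ M₂ = (M₁ ⊗ M₂) / 𝓛_{<0}.(M₁ ⊗ M₂)`. -/
def Odot : Type _ := (M₁ ⊗[ℂ] M₂) ⧸ odotRel V M₁ M₂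

instance : AddCommGroup (Odot V M₁ M₂) :=
  inferInstanceAs (AddCommGroup ((M₁ ⊗[ℂ] M₂) ⧸ odotRel V M₁ M₂))
instance : Module ℂ (Odot V M₁ M₂) :=
  inferInstanceAs (Module ℂ ((M₁ ⊗[ℂ] M₂) ⧸ odotRel V M₁ M₂))

variable {V M₁ M₂}

/-- The class `v₁ ⊙ v₂` of `v₁ ⊗ v₂` in `M₁ ⊙ M₂`. -/
def Odot.mk (V : Type*) [AddCommGroup V] [Module ℂ V] [VOA V]
    {M₁ : Type*} [AddCommGroup M₁] [Module ℂ M₁] [WeakModule V M₁]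
    {M₂ : Type*} [AddCommGroup M₂] [Module ℂ M₂] [WeakModule V M₂]
    (v₁ : M₁) (v₂ : M₂) : Odot V M₁ M₂ :=
  (odotRel V M₁ M₂).mkQ (v₁ ⊗ₜ[ℂ] v₂)

lemma tensorAct_tmul (x : BorcherdsLie V) (v₁ : M₁) (v₂ : M₂) :
    tensorAct V M₁ M₂ x (v₁ ⊗ₜ[ℂ] v₂)
      = actOne V M₁ x v₁ ⊗ₜ[ℂ] v₂ + v₁ ⊗ₜ[ℂ] actZero V M₂ x v₂ := rfl

lemma tensorAct_lie (x y : BorcherdsLie V) (u : M₁ ⊗[ℂ] M₂) :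
    tensorAct V M₁ M₂ ⁅x, y⁆ u = tensorAct V M₁ M₂ x (tensorAct V M₁ M₂ y u)
      - tensorAct V M₁ M₂ y (tensorAct V M₁ M₂ x u) := by
  induction u with
  | zero => simp
  | add u u' hu hu' => simp only [map_add, hu, hu']; abel
  | tmul v₁ v₂ =>
    simp only [tensorAct_tmul, map_add, actOne_lie, actZero_lie, TensorProduct.sub_tmul,
      TensorProduct.tmul_sub]
    abel

lemma tensorAct_mode_mem {q : ℤ} {c : V} (hc : c ∈ VOA.grade (V := V) q) {u : M₁ ⊗[ℂ] M₂}
    (hu : u ∈ odotRel V M₁ M₂) :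
    tensorAct V M₁ M₂ (mode (q - 1) c) u ∈ odotRel V M₁ M₂ := by
  suffices odotRel V M₁ M₂ ≤ (odotRel V M₁ M₂).comap (tensorAct V M₁ M₂ (mode (q - 1) c)) from
    this hu
  refine Submodule.span_le.2 ?_
  rintro _ ⟨p, a, n, m, v₁, v₂, ha, hnm, rfl⟩
  change tensorAct V M₁ M₂ (mode (q - 1) c) _ ∈ odotRel V M₁ M₂
  simp only [map_add, tensorAct_tmul, actOne_mode, actZero_mode]
  obtain ⟨I₁, h₁⟩ := rhoOne_commutator c a (q - 1) n m v₁
  obtain ⟨I₀, h₀⟩ := rhoZero_commutator c a (q - 1) n m v₂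
  have e₁ := h₁ (max I₁ I₀) (le_max_left _ _)
  have e₀ := h₀ (max I₁ I₀) (le_max_right _ _)
  rw [sub_eq_iff_eq_add] at e₁ e₀
  have hmem : ∀ i : ℕ, rhoOne (VOA.Y c i a) (q - 1 + n - i) m v₁ ⊗ₜ[ℂ] v₂
      + v₁ ⊗ₜ[ℂ] rhoZero (VOA.Y c i a) (q - 1 + n - i) m v₂ ∈ odotRel V M₁ M₂ := fun i =>
    Submodule.subset_span ⟨_, _, _, m, v₁, v₂, mode_mem_grade hc ha i, by omega, rfl⟩
  have m₁ : rhoOne a n m v₁ ⊗ₜ[ℂ] WeakModule.Y c (q - 1) v₂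
      + v₁ ⊗ₜ[ℂ] rhoZero a n m (WeakModule.Y c (q - 1) v₂) ∈ odotRel V M₁ M₂ :=
    Submodule.subset_span ⟨p, a, n, m, _, _, ha, hnm, rfl⟩
  have m₂ : rhoOne a n m (modeSum (q - 1) 0 c v₁) ⊗ₜ[ℂ] v₂
      + modeSum (q - 1) 0 c v₁ ⊗ₜ[ℂ] rhoZero a n m v₂ ∈ odotRel V M₁ M₂ :=
    Submodule.subset_span ⟨p, a, n, m, _, _, ha, hnm, rfl⟩
  have m₃ := Submodule.sum_mem (odotRel V M₁ M₂) (t := Finset.range (max I₁ I₀))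
    (f := fun i : ℕ => (Ring.choose (q - 1) i : ℤ) •
      (rhoOne (VOA.Y c i a) (q - 1 + n - i) m v₁ ⊗ₜ[ℂ] v₂
        + v₁ ⊗ₜ[ℂ] rhoZero (VOA.Y c i a) (q - 1 + n - i) m v₂))
    (fun i _ => zsmul_mem (hmem i) _)
  convert Submodule.add_mem _ (Submodule.add_mem _ m₁ m₂) m₃ using 1
  rw [e₁, e₀]
  simp only [smul_add, Finset.sum_add_distrib, TensorProduct.add_tmul, TensorProduct.tmul_add,
    TensorProduct.sum_tmul, TensorProduct.tmul_sum]
  have s₁ : ∀ (k : ℤ) (x : M₁), (k • x) ⊗ₜ[ℂ] v₂ = k • (x ⊗ₜ[ℂ] v₂) := fun k x =>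
    map_zsmul ((TensorProduct.mk ℂ M₁ M₂).flip v₂) k x
  have s₀ : ∀ (k : ℤ) (x : M₂), v₁ ⊗ₜ[ℂ] (k • x) = k • (v₁ ⊗ₜ[ℂ] x) := fun k x =>
    map_zsmul (TensorProduct.mk ℂ M₁ M₂ v₁) k x
  simp only [s₁, s₀]
  abel

lemma tensorAct_mem (x : BorcherdsLieZero V) {u : M₁ ⊗[ℂ] M₂} (hu : u ∈ odotRel V M₁ M₂) :
    tensorAct V M₁ M₂ x u ∈ odotRel V M₁ M₂ := by
  have hle : (BorcherdsLieZero V).toSubmodule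
      ≤ (odotRel V M₁ M₂).comap ((tensorAct V M₁ M₂).flip u) := by
    refine Submodule.span_le.2 ?_
    rintro _ ⟨q, c, hc, rfl⟩
    exact tensorAct_mode_mem hc hu
  exact hle x.2

variable (V M₁ M₂)

/-- The action of `L(V)_0` on `M₁ ⊙ M₂`. -/
def odotAct : BorcherdsLieZero V →ₗ[ℂ] Module.End ℂ (Odot V M₁ M₂) where
  toFun x := (odotRel V M₁ M₂).mapQ (odotRel V M₁ M₂) (tensorAct V M₁ M₂ x)
    fun _ hu => tensorAct_mem x hu
  map_add' x y := by
    refine LinearMap.ext fun u => ?_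
    obtain ⟨u, rfl⟩ := (odotRel V M₁ M₂).mkQ_surjective u
    change (odotRel V M₁ M₂).mkQ _ = (odotRel V M₁ M₂).mkQ _ + (odotRel V M₁ M₂).mkQ _
    rw [← map_add]
    exact congrArg _ (LinearMap.congr_fun (map_add (tensorAct V M₁ M₂) x.1 y.1) u)
  map_smul' c x := by
    refine LinearMap.ext fun u => ?_
    obtain ⟨u, rfl⟩ := (odotRel V M₁ M₂).mkQ_surjective u
    change (odotRel V M₁ M₂).mkQ _ = c • (odotRel V M₁ M₂).mkQ _
    rw [← map_smul]
    exact congrArg _ (LinearMap.congr_fun (map_smul (tensorAct V M₁ M₂) c x.1) u)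

/-- The `L(V)_0`-module structure of `M₁ ⊙ M₂`. -/
instance : LieRingModule (BorcherdsLieZero V) (Odot V M₁ M₂) where
  bracket x u := odotAct V M₁ M₂ x u
  add_lie x y u := LinearMap.congr_fun (map_add (odotAct V M₁ M₂) x y) u
  lie_add x u u' := map_add (odotAct V M₁ M₂ x) u u'
  leibniz_lie x y u := by
    obtain ⟨u, rfl⟩ := (odotRel V M₁ M₂).mkQ_surjective u
    change (odotRel V M₁ M₂).mkQ _ = (odotRel V M₁ M₂).mkQ _ + (odotRel V M₁ M₂).mkQ _
    rw [LieSubalgebra.coe_bracket, tensorAct_lie, ← map_add, sub_add_cancel]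

instance : LieModule ℂ (BorcherdsLieZero V) (Odot V M₁ M₂) where
  smul_lie c x u := LinearMap.congr_fun (map_smul (odotAct V M₁ M₂) c x) u
  lie_smul c x u := map_smul (odotAct V M₁ M₂ x) c u

variable {V M₁ M₂}

/-- `a_[wt a - 1].(v₁ ⊙ v₂) = (∑_{j ≥ 0} (wt a - 1 choose j) a(j) v₁) ⊙ v₂ + v₁ ⊙ a(wt a - 1) v₂`. -/
lemma Odot.lie_mk {p : ℤ} {a : V} (ha : a ∈ VOA.grade (V := V) p) (v₁ : M₁) (v₂ : M₂) :
    ⁅BorcherdsLieZero.of a, Odot.mk V v₁ v₂⁆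
      = Odot.mk V (modeSum (p - 1) 0 a v₁) v₂ + Odot.mk V v₁ (WeakModule.Y a (p - 1) v₂) := by
  change (odotRel V M₁ M₂).mkQ (tensorAct V M₁ M₂ (BorcherdsLieZero.of a) (v₁ ⊗ₜ[ℂ] v₂)) = _
  rw [BorcherdsLieZero.coe_of ha, tensorAct_tmul, actOne_mode, actZero_mode, map_add]
  rfl

end Odot

end VOATheory

end

/-!
For `a` of weight `p`, an element `a ⊗ f(z)` with `f = zⁿ/(z-1)ᵐ` acts on `M₁ ⊗ M₂` through its
residues at `z = 1` (on `M₁`) and `z = 0` (on `M₂`), and `M₁ ⊙ M₂` is obtained by killing the `f`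
with `n - m < p - 1`.  Since `z^(n+1)/(z-1)^(m+1) - zⁿ/(z-1)ᵐ = zⁿ/(z-1)^(m+1)`, all `f` with
`n - m = p - 1` act on `M₁ ⊙ M₂` as `a_[p-1]` does (`Odot.lie_mk_eq_rho`).  So `f` may be chosen to
suit the vectors it is applied to.

* On `v ⊙ w` with `w ∈ M₂(0)` take `f` with a zero of order at least `p` at `0`, so that the residue
  at `0` vanishes.  Then `f = zᵖ/(z-1)` gives `a_[p-1].(v ⊙ w) = (a ∗ v) ⊙ w`, and the relation for
  `f = zᵖ/(z-1)²` gives `O(M₁) ⊙ w = 0`.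
* On `w ⊙ v` with `w ∈ M₁(0)` take `f` with a zero of order at least `p` at `1`.  Let `σ` be the
  operator `(-1)ⁿ` on `M₂(n)`; it turns `(z-1)ᵖ` into `(1+z)ᵖ` up to a sign.  Hence
  `f = (z-1)ᵖ/z` gives `a_[p-1].(w ⊙ σ v) = w ⊙ σ (a ∗ v)`, and the relation for `f = (z-1)ᵖ/z²`
  gives `w ⊙ σ O(M₂) = 0`.

If `M₂` (or `M₁`) is generated by its bottom degree, then the `v ⊙ w` (or the `w ⊙ v`) span
`M₁ ⊙ M₂`, by a triangular elimination of modes (`Odot.iSup_range_bottom_right`,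
`Odot.iSup_range_bottom_left`).  In either case `M₁ ⊙ M₂` is spanned by images of `A(M₁)` or of
`A(M₂)` on which `a_[p-1]` acts as `[a]`, so that the module axioms of `A(Mᵢ)` over `A(V)` pass to
`M₁ ⊙ M₂` (`exists_zhuAlgebra_module`).

The relation for `f = z^(p-1)/(z-1)` gives `(v ∗ a) ⊙ w = v ⊙ o(a) w` for `w ∈ M₂(0)`, so
`[v] ⊗ w ↦ v ⊙ w` is well defined on `A(M₁) ⊗_{A(V)} M₂(0)`; it is onto if `M₂(0)` generates `M₂`,
and composition with it embeds the `L(V)_0`-homomorphisms `M₁ ⊙ M₂ → M₃(0)` into the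
`A(V)`-homomorphisms.
-/

namespace VOATheory

/-! ### The criterion for an action of Zhu's algebra -/

section Criterion

variable {V : Type*} [AddCommGroup V] [Module ℂ V] [VOA V]
  {M : Type*} [AddCommGroup M] [Module ℂ M] [WeakModule V M]
  {W : Type*} [AddCommGroup W] [Module ℂ W]
  [LieRingModule (BorcherdsLieZero V) W] [LieModule ℂ (BorcherdsLieZero V) W]

/-- If an `L(V)_0`-module `W` is spanned by the images of linear maps `M → W` that factor through
`A(M)` and carry `a ∗ v` to the action of `a_[wt a - 1]` on the image of `v`, then the action of
`L(V)_0` on `W` is the pull-back of an `A(V)`-module structure. -/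
lemma exists_zhuAlgebra_module {ι : Type*} (g : ι → M →ₗ[ℂ] W)
    (hO : ∀ i, ∀ v ∈ zhuO V M, g i v = 0)
    (hg : ∀ i (a : V) (v : M), ⁅BorcherdsLieZero.of a, g i v⁆ = g i (zhuStar V M a v))
    (hspan : ⨆ i, LinearMap.range (g i) = ⊤) :
    ∃ _ : Module (ZhuAlgebra V) W, IsScalarTower ℂ (ZhuAlgebra V) W ∧
      ∀ (x : BorcherdsLieZero V) (u : W), ⁅x, u⁆ = BorcherdsLieZero.toZhu x • u := by
  have hext : ∀ f f' : W →ₗ[ℂ] W, (∀ i v, f (g i v) = f' (g i v)) → f = f' := by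
    intro f f' h
    have hle : ⨆ i, LinearMap.range (g i) ≤ LinearMap.eqLocus f f' := by
      refine iSup_le fun i => ?_
      rintro _ ⟨v, rfl⟩
      exact h i v
    rw [hspan] at hle
    exact LinearMap.ext fun u => hle Submodule.mem_top
  have hO' : ∀ i (v v' : M), v - v' ∈ zhuO V M → g i v = g i v' := by
    intro i v v' h
    rw [← sub_eq_zero, ← map_sub]
    exact hO i _ h
  let actV : V →ₗ[ℂ] Module.End ℂ W :=
    (LieModule.toEnd ℂ (BorcherdsLieZero V) W : BorcherdsLieZero V →ₗ[ℂ] Module.End ℂ W)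
      ∘ₗ BorcherdsLieZero.of
  have hact : ∀ i (a : V) (v : M), actV a (g i v) = g i (zhuStar V M a v) := hg
  have hker : zhuO V V ≤ LinearMap.ker actV := fun a ha => by
    refine LinearMap.mem_ker.2 (hext _ _ fun i v => ?_)
    rw [hact, hO i _ (zhuO_zhuStar ha v), LinearMap.zero_apply]
  let act : ZhuAlgebra V →ₗ[ℂ] Module.End ℂ W := (zhuO V V).liftQ actV hker
  have act_mk : ∀ a, act (ZhuAlgebra.mk a) = actV a := fun _ => rfl
  have act_one : act 1 = LinearMap.id := hext _ _ fun i v => by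
    rw [← ZhuAlgebra.mk_vac, act_mk, hact, zhuStar_vac, LinearMap.id_apply]
  have act_mul : ∀ x y, act (x * y) = act x ∘ₗ act y := fun x y => by
    obtain ⟨a, rfl⟩ := ZhuAlgebra.mk_surjective x
    obtain ⟨b, rfl⟩ := ZhuAlgebra.mk_surjective y
    refine hext _ _ fun i v => ?_
    rw [ZhuAlgebra.mk_mul, LinearMap.comp_apply, act_mk, act_mk, act_mk, hact, hact, hact]
    exact hO' i _ _ (zhuStar_assoc a b v)
  let inst : Module (ZhuAlgebra V) W :=
    { smul := fun x u => act x u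
      one_smul := fun u => LinearMap.congr_fun act_one u
      mul_smul := fun x y u => LinearMap.congr_fun (act_mul x y) u
      smul_zero := fun x => map_zero (act x)
      smul_add := fun x => map_add (act x)
      add_smul := fun x y u => LinearMap.congr_fun (map_add act x y) u
      zero_smul := fun u => LinearMap.congr_fun (map_zero act) u }
  refine ⟨inst, ⟨fun c x u => LinearMap.congr_fun (map_smul act c x) u⟩, fun x u => ?_⟩
  obtain ⟨a, rfl⟩ := BorcherdsLieZero.of_surjective x
  rw [BorcherdsLieZero.toZhu_of]
  rfl

end Criterion

/-! ### Residues at `0` and `1` modulo the contraction relations -/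

section Residues

variable {V : Type*} [AddCommGroup V] [Module ℂ V] [VOA V]

section Pascal

variable {M : Type*} [AddCommGroup M] [Module ℂ M] [WeakModule V M]

/-- The identity `z^(n+1)/(z-1)^(m+1) = zⁿ/(z-1)ᵐ + zⁿ/(z-1)^(m+1)` at the point `1`. -/
lemma rhoOne_succ_succ (a : V) (n m : ℤ) (v : M) :
    rhoOne a (n + 1) (m + 1) v = rhoOne a n m v + rhoOne a n (m + 1) v := by
  rw [rhoOne, rhoOne, rhoOne, modeSum_succ, show -(m + 1) + 1 = -m by ring, add_comm]

/-- The identity `z^(n+1)/(z-1)^(m+1) = zⁿ/(z-1)ᵐ + zⁿ/(z-1)^(m+1)` at the point `0`. -/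
lemma rhoZero_succ_succ (a : V) (n m : ℤ) (v : M) :
    rhoZero a (n + 1) (m + 1) v = rhoZero a n m v + rhoZero a n (m + 1) v := by
  obtain ⟨N, hN⟩ := exists_trunc a v n
  rw [rhoZero_eq a (n + 1) (m + 1) v N (fun i hi => hN i (by omega)),
    rhoZero_eq a n m v (N + 1) (fun i hi => hN i (by push_cast at hi; omega)),
    rhoZero_eq a n (m + 1) v (N + 1) (fun i hi => hN i (by push_cast at hi; omega)),
    ← Finset.sum_add_distrib, Finset.sum_range_succ' _ N]
  have h0 : (((-m - ((0 : ℕ) : ℤ)).negOnePow : ℤ) * Ring.choose (-m) 0) •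
        WeakModule.Y a (n + ((0 : ℕ) : ℤ)) v
      + (((-(m + 1) - ((0 : ℕ) : ℤ)).negOnePow : ℤ) * Ring.choose (-(m + 1)) 0) •
        WeakModule.Y a (n + ((0 : ℕ) : ℤ)) v = 0 := by
    rw [← add_smul, show -(m + 1) - ((0 : ℕ) : ℤ) = -m - ((0 : ℕ) : ℤ) - 1 by ring,
      Int.negOnePow_sub _ 1, Int.negOnePow_one]
    simp
  rw [h0, add_zero]
  refine Finset.sum_congr rfl fun j _ => ?_
  have hC := Ring.choose_succ_succ (-(m + 1)) j
  rw [show -(m + 1) + 1 = -m by ring] at hC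
  rw [← add_smul, show n + 1 + (j : ℤ) = n + ((j + 1 : ℕ) : ℤ) by push_cast; ring, hC,
    show -m - ((j + 1 : ℕ) : ℤ) = -(m + 1) - j by push_cast; ring,
    show -(m + 1) - ((j + 1 : ℕ) : ℤ) = -(m + 1) - j - 1 by push_cast; ring,
    Int.negOnePow_sub _ 1, Int.negOnePow_one]
  congr 1
  push_cast
  ring

lemma rhoZero_zero (a : V) (n : ℤ) (v : M) : rhoZero a n 0 v = WeakModule.Y a n v := by
  obtain ⟨N, hN⟩ := exists_trunc a v n
  rw [rhoZero_eq a n 0 v (N + 1) (fun i hi => hN i (by push_cast at hi; omega)),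
    Finset.sum_range_succ', Finset.sum_eq_zero, zero_add]
  · simp
  · intro j _
    rw [neg_zero, Ring.choose_zero_succ, mul_zero, zero_smul]

lemma rhoZero_eq_zero (a : V) (n m : ℤ) (v : M) (h : ∀ i : ℤ, n ≤ i → WeakModule.Y a i v = 0) :
    rhoZero a n m v = 0 := by
  rw [rhoZero_eq a n m v 0 (fun i hi => h i (by simpa using hi)), Finset.sum_range_zero]

end Pascal

variable {M₁ : Type*} [AddCommGroup M₁] [Module ℂ M₁]
  {M₂ : Type*} [AddCommGroup M₂] [Module ℂ M₂]

section Weak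

variable [WeakModule V M₁] [WeakModule V M₂]

/-- The bilinear map `(v₁, v₂) ↦ v₁ ⊙ v₂`. -/
def Odot.bilin (V : Type*) [AddCommGroup V] [Module ℂ V] [VOA V]
    (M₁ : Type*) [AddCommGroup M₁] [Module ℂ M₁] [WeakModule V M₁]
    (M₂ : Type*) [AddCommGroup M₂] [Module ℂ M₂] [WeakModule V M₂] :
    M₁ →ₗ[ℂ] M₂ →ₗ[ℂ] Odot V M₁ M₂ :=
  (TensorProduct.mk ℂ M₁ M₂).compr₂ (odotRel V M₁ M₂).mkQ

lemma Odot.bilin_apply (v₁ : M₁) (v₂ : M₂) : Odot.bilin V M₁ M₂ v₁ v₂ = Odot.mk V v₁ v₂ := rfl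

lemma Odot.span_eq_top (S : Submodule ℂ (Odot V M₁ M₂)) (h : ∀ v₁ v₂, Odot.mk V v₁ v₂ ∈ S) :
    S = ⊤ := by
  rw [eq_top_iff]
  rintro u -
  obtain ⟨u, rfl⟩ := (odotRel V M₁ M₂).mkQ_surjective u
  induction u with
  | zero => rw [map_zero]; exact S.zero_mem
  | add x y hx hy => rw [map_add]; exact S.add_mem hx hy
  | tmul v₁ v₂ => exact h v₁ v₂

lemma Odot.mk_rho_eq_zero {p : ℤ} {a : V} (ha : a ∈ VOA.grade (V := V) p) {n m : ℤ}
    (hnm : n - m < p - 1) (v₁ : M₁) (v₂ : M₂) :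
    Odot.mk V (rhoOne a n m v₁) v₂ + Odot.mk V v₁ (rhoZero a n m v₂) = 0 := by
  change (odotRel V M₁ M₂).mkQ _ + (odotRel V M₁ M₂).mkQ _ = 0
  rw [← map_add]
  exact (Submodule.Quotient.mk_eq_zero _).2 (Submodule.subset_span ⟨p, a, n, m, v₁, v₂, ha, hnm, rfl⟩)

/-- All functions `zⁿ/(z-1)ᵐ` of degree `n - m = wt a - 1` at infinity act on `M₁ ⊙ M₂` in the
same way, because `z^(n+1)/(z-1)^(m+1) - zⁿ/(z-1)ᵐ` acts as zero; so each of them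
computes the action of `a_[wt a - 1]`. -/
lemma Odot.lie_mk_eq_rho {p : ℤ} {a : V} (ha : a ∈ VOA.grade (V := V) p) {n m : ℤ}
    (hnm : n - m = p - 1) (v₁ : M₁) (v₂ : M₂) :
    ⁅BorcherdsLieZero.of a, Odot.mk V v₁ v₂⁆
      = Odot.mk V (rhoOne a n m v₁) v₂ + Odot.mk V v₁ (rhoZero a n m v₂) := by
  obtain rfl : n = p - 1 + m := by omega
  have step : ∀ k : ℤ, Odot.mk V (rhoOne a (p - 1 + (k + 1)) (k + 1) v₁) v₂
        + Odot.mk V v₁ (rhoZero a (p - 1 + (k + 1)) (k + 1) v₂)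
      = Odot.mk V (rhoOne a (p - 1 + k) k v₁) v₂
        + Odot.mk V v₁ (rhoZero a (p - 1 + k) k v₂) := by
    intro k
    have h := Odot.mk_rho_eq_zero ha (n := p - 1 + k) (m := k + 1) (by omega) v₁ v₂
    rw [← add_assoc, rhoOne_succ_succ, rhoZero_succ_succ]
    simp only [← Odot.bilin_apply, map_add, LinearMap.add_apply] at h ⊢
    rw [add_add_add_comm, h, add_zero]
  induction m using Int.induction_on with
  | zero => rw [Odot.lie_mk ha, add_zero, rhoZero_zero, rhoOne, neg_zero]
  | succ k ih => rw [step, ih (by ring)]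
  | pred k ih =>
    rw [ih (by ring), ← step (-k - 1), sub_add_cancel]

end Weak

/-! ### Spanning by the bottom degree -/

section Spanning

variable [AdmissibleModule V M₁] [AdmissibleModule V M₂]

/-- To see that a subspace is stable under a mode `a(n)`, it may be assumed that the higher modes
of `a` map the given vector into it, because all but finitely many of these vanish. -/
lemma GeneratedByBottom.eq_top {M : Type*} [AddCommGroup M] [Module ℂ M] [AdmissibleModule V M]
    (h : GeneratedByBottom V M) (N : Submodule ℂ M)
    (hN : AdmissibleModule.grade (V := V) (M := M) 0 ≤ N)
    (hY : ∀ (p : ℤ), ∀ a ∈ VOA.grade (V := V) p, ∀ (n : ℤ), ∀ u ∈ N,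
      (∀ i : ℤ, n < i → WeakModule.Y a i u ∈ N) → WeakModule.Y a n u ∈ N) : N = ⊤ := by
  refine h N hN fun a n u hu => ?_
  refine homogeneous_induction (P := fun a => WeakModule.Y a n u ∈ N) ?_ ?_ ?_ a
  · simp
  · intro a b ha hb
    rw [map_add, Pi.add_apply, LinearMap.add_apply]
    exact N.add_mem ha hb
  intro p a ha
  obtain ⟨K, hK⟩ := exists_trunc a u n
  have key : ∀ k : ℕ, ∀ i : ℤ, n + K - k ≤ i → WeakModule.Y a i u ∈ N := by
    intro k
    induction k with
    | zero => exact fun i hi => by rw [hK i (by simpa using hi)]; exact N.zero_mem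
    | succ k ih =>
      exact fun i hi => hY p a ha i u hu fun j hj => ih j (by push_cast at hi; omega)
  exact key K n (by omega)

/-- If `M₂` is generated by `M₂(0)`, then the elements `v ⊙ w` with `w ∈ M₂(0)` span `M₁ ⊙ M₂`:
the relation for `zⁿ/(z-1)ᵐ` with `m` large expresses `v₁ ⊙ a(n) v₂` by the `v₁ ⊙ a(i) v₂` with
`i > n` and some `v ⊙ v₂`. -/
lemma Odot.iSup_range_bottom_right (h : GeneratedByBottom V M₂) :
    ⨆ w : Bottom V M₂, LinearMap.range ((Odot.bilin V M₁ M₂).flip w) = ⊤ := by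
  set S := ⨆ w : Bottom V M₂, LinearMap.range ((Odot.bilin V M₁ M₂).flip w)
  let N : Submodule ℂ M₂ := ⨅ v₁ : M₁, S.comap (Odot.bilin V M₁ M₂ v₁)
  have hN : ∀ v₂, v₂ ∈ N ↔ ∀ v₁, Odot.mk V v₁ v₂ ∈ S := fun v₂ => by
    simp only [N, Submodule.mem_iInf, Submodule.mem_comap, Odot.bilin_apply]
  suffices N = ⊤ from Odot.span_eq_top S fun v₁ v₂ =>
    (hN v₂).1 (this ▸ Submodule.mem_top) v₁
  refine h.eq_top N (fun w hw => (hN w).2 fun v₁ => ?_) fun p a ha n u hu hi => ?_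
  · exact Submodule.mem_iSup_of_mem (⟨w, hw⟩ : Bottom V M₂) ⟨v₁, rfl⟩
  rw [hN]
  intro v₁
  obtain ⟨K, hK⟩ := exists_trunc a u n
  have hrel := Odot.mk_rho_eq_zero ha (n := n) (m := n - p + 2) (by omega) v₁ u
  rw [rhoZero_eq a n _ u (K + 1) (fun i hi => hK i (by push_cast at hi; omega)),
    Finset.sum_range_succ'] at hrel
  simp only [Nat.cast_zero, add_zero, sub_zero, Ring.choose_zero_right, mul_one] at hrel
  rw [← Odot.bilin_apply v₁, map_add, map_zsmul, ← add_assoc, add_comm,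
    ← eq_neg_iff_add_eq_zero] at hrel
  have hmem : ((-(n - p + 2)).negOnePow : ℤ) • Odot.bilin V M₁ M₂ v₁ (WeakModule.Y a n u) ∈ S := by
    rw [hrel]
    refine S.neg_mem (S.add_mem ((hN u).1 hu _) ?_)
    refine (hN _).1 (N.sum_mem fun j _ => zsmul_mem (hi _ ?_) _) v₁
    push_cast
    omega
  have := zsmul_mem hmem ((-(n - p + 2)).negOnePow : ℤ)
  rwa [smul_smul, ← Units.val_mul, Int.units_mul_self, Units.val_one, one_smul] at this

/-- If `M₁` is generated by `M₁(0)`, then the elements `w ⊙ v` with `w ∈ M₁(0)` span `M₁ ⊙ M₂`: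
the relation for `zⁿ/(z-1)ᵐ` with `n` very negative expresses `a(-m) v₁ ⊙ v₂` by the
`a(i) v₁ ⊙ v₂` with `i > -m` and some `v₁ ⊙ v`. -/
lemma Odot.iSup_range_bottom_left (h : GeneratedByBottom V M₁) :
    ⨆ w : Bottom V M₁, LinearMap.range (Odot.bilin V M₁ M₂ w) = ⊤ := by
  set S := ⨆ w : Bottom V M₁, LinearMap.range (Odot.bilin V M₁ M₂ w)
  let N : Submodule ℂ M₁ := ⨅ v₂ : M₂, S.comap ((Odot.bilin V M₁ M₂).flip v₂)
  have hN : ∀ v₁, v₁ ∈ N ↔ ∀ v₂, Odot.mk V v₁ v₂ ∈ S := fun v₁ => by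
    simp only [N, Submodule.mem_iInf, Submodule.mem_comap, LinearMap.flip_apply, Odot.bilin_apply]
  suffices N = ⊤ from Odot.span_eq_top S fun v₁ v₂ =>
    (hN v₁).1 (this ▸ Submodule.mem_top) v₂
  refine h.eq_top N (fun w hw => (hN w).2 fun v₂ => ?_) fun p a ha n u hu hi => ?_
  · exact Submodule.mem_iSup_of_mem (⟨w, hw⟩ : Bottom V M₁) ⟨v₂, rfl⟩
  rw [hN]
  intro v₂
  obtain ⟨K, hK⟩ := exists_trunc a u n
  have hrel := Odot.mk_rho_eq_zero ha (n := p - n - 2) (m := -n) (by omega) u v₂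
  rw [rhoOne, neg_neg, modeSum_eq _ n a u (K + 1) (fun i hi => hK i (by push_cast at hi; omega)),
    Finset.sum_range_succ'] at hrel
  simp only [Nat.cast_zero, add_zero, Ring.choose_zero_right, one_smul] at hrel
  rw [← Odot.bilin_apply _ v₂, map_add, LinearMap.add_apply, add_right_comm, add_comm,
    ← eq_neg_iff_add_eq_zero] at hrel
  rw [← Odot.bilin_apply, hrel]
  refine S.neg_mem (S.add_mem ?_ ((hN u).1 hu _))
  refine (hN _).1 (N.sum_mem fun j _ => zsmul_mem (hi _ ?_) _) v₂
  push_cast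
  omega

end Spanning

end Residues

/-! ### Elements of bottom degree on either side -/

section BottomRight

variable {V : Type*} [AddCommGroup V] [Module ℂ V] [VOA V]
  {M₁ : Type*} [AddCommGroup M₁] [Module ℂ M₁] [WeakModule V M₁]
  {M₂ : Type*} [AddCommGroup M₂] [Module ℂ M₂] [AdmissibleModule V M₂]

/-- `O(M₁) ⊙ M₂(0) = 0`. -/
lemma Odot.mk_zhuO_bottom {x : M₁} (hx : x ∈ zhuO V M₁) (w : Bottom V M₂) :
    Odot.mk V x (w : M₂) = 0 := by
  suffices zhuO V M₁ ≤ LinearMap.ker ((Odot.bilin V M₁ M₂).flip w) from this hx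
  refine zhuO_le fun p a ha v => ?_
  -- the relation for the function `zᵖ/(z-1)²`
  have h := Odot.mk_rho_eq_zero ha (n := p) (m := 2) (by omega) v (w : M₂)
  rwa [rhoZero_eq_zero a p 2 _ fun i hi => mode_bottom_eq_zero ha w.2 hi, ← Odot.bilin_apply v,
    map_zero, add_zero] at h

/-- `a_[wt a - 1].(v ⊙ w) = (a ∗ v) ⊙ w` for `w ∈ M₂(0)`. -/
lemma Odot.lie_mk_bottom (a : V) (v : M₁) (w : Bottom V M₂) :
    ⁅BorcherdsLieZero.of a, Odot.mk V v (w : M₂)⁆ = Odot.mk V (zhuStar V M₁ a v) (w : M₂) := by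
  refine homogeneous_induction (P := fun a => ⁅BorcherdsLieZero.of a, Odot.mk V v (w : M₂)⁆
    = Odot.mk V (zhuStar V M₁ a v) (w : M₂)) ?_ ?_ ?_ a
  · simp [← Odot.bilin_apply]
  · intro a b ha hb
    rw [map_add, add_lie, ha, hb, map_add, ← Odot.bilin_apply, ← Odot.bilin_apply,
      ← Odot.bilin_apply, LinearMap.add_apply, map_add, LinearMap.add_apply]
  intro p a ha
  -- the action of `a_[p - 1]` is computed by the function `zᵖ/(z-1)`
  rw [Odot.lie_mk_eq_rho ha (n := p) (m := 1) (by ring),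
    rhoZero_eq_zero a p 1 _ fun i hi => mode_bottom_eq_zero ha w.2 hi, ← Odot.bilin_apply v,
    map_zero, add_zero, zhuStar_of_mem ha, rhoOne]

/-- `(v ∗ a) ⊙ w = v ⊙ o(a) w` for `w ∈ M₂(0)`. -/
lemma Odot.mk_zhuStarRight_bottom (a : V) (v : M₁) (w : Bottom V M₂) :
    Odot.mk V (zhuStarRight V M₁ a v) (w : M₂) = Odot.mk V v (zeroMode V M₂ a w) := by
  refine homogeneous_induction (P := fun a => Odot.mk V (zhuStarRight V M₁ a v) (w : M₂)
    = Odot.mk V v (zeroMode V M₂ a w)) ?_ ?_ ?_ a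
  · simp [← Odot.bilin_apply]
  · intro a b ha hb
    simp only [← Odot.bilin_apply, map_add, LinearMap.add_apply] at ha hb ⊢
    rw [ha, hb]
  intro p a ha
  -- the relation for the function `z^(p-1)/(z-1)`
  have h := Odot.mk_rho_eq_zero ha (n := p - 1) (m := 1) (by omega) v (w : M₂)
  rw [rhoZero_eq a (p - 1) 1 _ 1 fun i hi =>
      mode_bottom_eq_zero ha w.2 (by push_cast at hi; omega)] at h
  rw [zhuStarRight_of_mem ha, zeroMode_of_mem ha, ← sub_eq_zero, ← h, rhoOne]
  simp [← Odot.bilin_apply, sub_eq_add_neg]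

end BottomRight

section Sign

variable (V : Type*) [AddCommGroup V] [Module ℂ V] [VOA V]
  (M : Type*) [AddCommGroup M] [Module ℂ M] [AdmissibleModule V M]

/-- The operator on an admissible module that is `(-1)ⁿ` on `M(n)`. -/
noncomputable def gradeSign : M →ₗ[ℂ] M :=
  DirectSum.toModule ℂ ℕ M
      (fun n => ((-1 : ℂ) ^ n) • (AdmissibleModule.grade (V := V) (M := M) n).subtype) ∘ₗ
    (LinearEquiv.ofBijective
      (DirectSum.coeLinearMap (AdmissibleModule.grade (V := V) (M := M)))
      (show Function.Bijective (DirectSum.coeLinearMap (AdmissibleModule.grade (V := V) (M := M)))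
        from AdmissibleModule.isInternal)).symm.toLinearMap

variable {V M}

lemma gradeSign_of_mem {n : ℕ} {u : M} (hu : u ∈ AdmissibleModule.grade (V := V) n) :
    gradeSign V M u = (n : ℤ).negOnePow • u := by
  have : (LinearEquiv.ofBijective
      (DirectSum.coeLinearMap (AdmissibleModule.grade (V := V) (M := M)))
      (show Function.Bijective (DirectSum.coeLinearMap (AdmissibleModule.grade (V := V) (M := M)))
        from AdmissibleModule.isInternal)).symm u = DirectSum.lof ℂ ℕ
          (fun n => AdmissibleModule.grade (V := V) (M := M) n) n ⟨u, hu⟩ := by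
    rw [LinearEquiv.symm_apply_eq]
    rw [LinearEquiv.ofBijective_apply, DirectSum.lof_eq_of, DirectSum.coeLinearMap_of]
  rw [gradeSign, LinearMap.comp_apply, LinearEquiv.coe_coe, this, DirectSum.toModule_lof,
    LinearMap.smul_apply, Submodule.subtype_apply, Units.smul_def, negOnePow_natCast',
    ← Int.cast_smul_eq_zsmul ℂ]
  push_cast
  rfl

variable (V) in
lemma grade_induction {P : M → Prop} (h0 : P 0) (hadd : ∀ u v, P u → P v → P (u + v))
    (hP : ∀ (n : ℕ), ∀ u ∈ AdmissibleModule.grade (V := V) n, P u) (u : M) : P u := by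
  have : u ∈ ⨆ n, AdmissibleModule.grade (V := V) (M := M) n := by
    rw [AdmissibleModule.isInternal.submodule_iSup_eq_top]; trivial
  exact Submodule.iSup_induction _ (motive := P) this hP h0 hadd

lemma gradeSign_gradeSign (u : M) : gradeSign V M (gradeSign V M u) = u := by
  refine grade_induction V (P := fun u => gradeSign V M (gradeSign V M u) = u) ?_ ?_ ?_ u
  · simp
  · intro u v hu hv
    rw [map_add, map_add, hu, hv]
  intro n u hu
  rw [gradeSign_of_mem hu, Units.smul_def, map_zsmul, gradeSign_of_mem hu, Units.smul_def,
    smul_smul, ← Units.val_mul, Int.units_mul_self, Units.val_one, one_smul]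

lemma mode_gradeSign {p : ℤ} {a : V} (ha : a ∈ VOA.grade (V := V) p) (k : ℤ) (u : M) :
    WeakModule.Y a k (gradeSign V M u)
      = (p - k - 1).negOnePow • gradeSign V M (WeakModule.Y a k u) := by
  refine grade_induction V (P := fun u => WeakModule.Y a k (gradeSign V M u)
      = (p - k - 1).negOnePow • gradeSign V M (WeakModule.Y a k u)) ?_ ?_ ?_ u
  · simp
  · intro u v hu hv
    simp only [map_add, hu, hv, smul_add]
  intro n u hu
  rw [gradeSign_of_mem hu, Units.smul_def, map_zsmul]
  rcases lt_or_ge ((n : ℤ) + p - k - 1) 0 with h | h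
  · rw [AdmissibleModule.grading_neg p a ha k n u hu h, smul_zero, map_zero, smul_zero]
  · obtain ⟨d, hd⟩ := Int.eq_ofNat_of_zero_le h
    rw [gradeSign_of_mem (AdmissibleModule.grading p a ha k n u hu d hd.symm), smul_smul,
      ← Int.negOnePow_add, ← hd, ← Units.smul_def,
      show p - k - 1 + ((n : ℤ) + p - k - 1) = n + 2 * (p - k - 1) by ring, Int.negOnePow_add,
      Int.negOnePow_two_mul, mul_one]

/-- The residues at `0` for `zⁿ(z-1)ᵖ` and for `zⁿ(1+z)ᵖ` correspond under the sign operator, up to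
a sign: `z ↦ -z` exchanges the two functions, and `a(k)` shifts degrees by `p - k - 1`. -/
lemma rhoZero_gradeSign {p : ℤ} {a : V} (ha : a ∈ VOA.grade (V := V) p) (n : ℤ) (u : M) :
    rhoZero a n (-p) (gradeSign V M u)
      = (n + 1).negOnePow • gradeSign V M (modeSum p n a u) := by
  obtain ⟨N, hN⟩ := exists_trunc a u n
  have hN' : ∀ i : ℤ, n + N ≤ i → WeakModule.Y a i (gradeSign V M u) = 0 := fun i hi => by
    rw [mode_gradeSign ha, hN i hi, map_zero, smul_zero]
  rw [rhoZero_eq a n (-p) _ N hN', modeSum_eq p n a u N hN, map_sum, Finset.smul_sum]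
  refine Finset.sum_congr rfl fun j _ => ?_
  rw [mode_gradeSign ha, map_zsmul, Units.smul_def, Units.smul_def, smul_smul, smul_smul, neg_neg,
    mul_right_comm, ← Units.val_mul, ← Int.negOnePow_add,
    show p - (j : ℤ) + (p - (n + j) - 1) = n + 1 + 2 * (p - n - j - 1) by ring,
    Int.negOnePow_add, Int.negOnePow_two_mul, mul_one]

end Sign

section BottomLeft

variable {V : Type*} [AddCommGroup V] [Module ℂ V] [VOA V]
  {M₁ : Type*} [AddCommGroup M₁] [Module ℂ M₁] [AdmissibleModule V M₁]
  {M₂ : Type*} [AddCommGroup M₂] [Module ℂ M₂] [AdmissibleModule V M₂]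

/-- `M₁(0) ⊙ σ O(M₂) = 0`, where `σ` is the sign operator. -/
lemma Odot.mk_bottom_gradeSign_zhuO (w : Bottom V M₁) {x : M₂} (hx : x ∈ zhuO V M₂) :
    Odot.mk V (w : M₁) (gradeSign V M₂ x) = 0 := by
  suffices zhuO V M₂ ≤ LinearMap.ker (Odot.bilin V M₁ M₂ w ∘ₗ gradeSign V M₂) from this hx
  refine zhuO_le fun p a ha v => ?_
  -- the relation for the function `z⁻²(z-1)ᵖ`
  have h := Odot.mk_rho_eq_zero ha (n := -2) (m := -p) (by omega) (w : M₁) (gradeSign V M₂ v)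
  rw [rhoOne, neg_neg, modeSum_eq_zero _ p a _ fun i hi => mode_bottom_eq_zero ha w.2 hi,
    rhoZero_gradeSign ha, show (-2 : ℤ) + 1 = -1 by norm_num, Int.negOnePow_neg,
    Int.negOnePow_one, Units.neg_smul, one_smul, ← Odot.bilin_apply, ← Odot.bilin_apply, map_zero,
    LinearMap.zero_apply, zero_add, map_neg, neg_eq_zero] at h
  exact h

/-- `a_[wt a - 1].(w ⊙ σ v) = w ⊙ σ (a ∗ v)` for `w ∈ M₁(0)`, where `σ` is the sign operator. -/
lemma Odot.lie_mk_bottom_gradeSign (a : V) (w : Bottom V M₁) (v : M₂) :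
    ⁅BorcherdsLieZero.of a, Odot.mk V (w : M₁) (gradeSign V M₂ v)⁆
      = Odot.mk V (w : M₁) (gradeSign V M₂ (zhuStar V M₂ a v)) := by
  refine homogeneous_induction (P := fun a =>
    ⁅BorcherdsLieZero.of a, Odot.mk V (w : M₁) (gradeSign V M₂ v)⁆
      = Odot.mk V (w : M₁) (gradeSign V M₂ (zhuStar V M₂ a v))) ?_ ?_ ?_ a
  · simp [← Odot.bilin_apply]
  · intro a b ha hb
    rw [map_add, add_lie, ha, hb, map_add, ← Odot.bilin_apply, ← Odot.bilin_apply,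
      ← Odot.bilin_apply, LinearMap.add_apply, map_add, map_add]
  intro p a ha
  -- the action of `a_[p - 1]` is computed by the function `z⁻¹(z-1)ᵖ`
  rw [Odot.lie_mk_eq_rho ha (n := -1) (m := -p) (by ring), rhoOne, neg_neg,
    modeSum_eq_zero _ p a _ fun i hi => mode_bottom_eq_zero ha w.2 hi, rhoZero_gradeSign ha,
    neg_add_cancel, Int.negOnePow_zero, one_smul, ← Odot.bilin_apply, map_zero,
    LinearMap.zero_apply, zero_add, zhuStar_of_mem ha]

end BottomLeft

/-! ### The action of Zhu's algebra on the contracted tensor product -/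

section Action

variable {V : Type*} [AddCommGroup V] [Module ℂ V] [VOA V]
  {M₁ : Type*} [AddCommGroup M₁] [Module ℂ M₁] [AdmissibleModule V M₁]
  {M₂ : Type*} [AddCommGroup M₂] [Module ℂ M₂] [AdmissibleModule V M₂]

lemma Odot.exists_zhuAlgebra_module (h : GeneratedByBottom V M₁ ∨ GeneratedByBottom V M₂) :
    ∃ _ : Module (ZhuAlgebra V) (Odot V M₁ M₂), IsScalarTower ℂ (ZhuAlgebra V) (Odot V M₁ M₂) ∧
      ∀ (x : BorcherdsLieZero V) (u : Odot V M₁ M₂), ⁅x, u⁆ = BorcherdsLieZero.toZhu x • u := by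
  rcases h with h | h
  · refine VOATheory.exists_zhuAlgebra_module (M := M₂)
      (fun w : Bottom V M₁ => Odot.bilin V M₁ M₂ w ∘ₗ gradeSign V M₂)
      (fun w v hv => Odot.mk_bottom_gradeSign_zhuO w hv)
      (fun w a v => Odot.lie_mk_bottom_gradeSign a w v) ?_
    have hσ : LinearMap.range (gradeSign V M₂) = ⊤ :=
      LinearMap.range_eq_top.2 fun u => ⟨_, gradeSign_gradeSign u⟩
    simp only [LinearMap.range_comp_of_range_eq_top _ hσ]
    exact Odot.iSup_range_bottom_left h
  · exact VOATheory.exists_zhuAlgebra_module (M := M₁)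
      (fun w : Bottom V M₂ => (Odot.bilin V M₁ M₂).flip w)
      (fun w v hv => Odot.mk_zhuO_bottom hv w) (fun w a v => Odot.lie_mk_bottom a v w)
      (Odot.iSup_range_bottom_right h)

/-- `a_[wt a - 1].(v₁ ⊙ v₂) = (a ∗ v₁ - v₁ ∗ a) ⊙ v₂ + v₁ ⊙ o(a) v₂`. -/
lemma Odot.lie_mk_eq_zhuStar_sub (a : V) (v₁ : M₁) (v₂ : M₂) :
    ⁅BorcherdsLieZero.of a, Odot.mk V v₁ v₂⁆
      = Odot.mk V (zhuStar V M₁ a v₁ - zhuStarRight V M₁ a v₁) v₂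
        + Odot.mk V v₁ (zeroMode V M₂ a v₂) := by
  refine homogeneous_induction (P := fun a => ⁅BorcherdsLieZero.of a, Odot.mk V v₁ v₂⁆
      = Odot.mk V (zhuStar V M₁ a v₁ - zhuStarRight V M₁ a v₁) v₂
        + Odot.mk V v₁ (zeroMode V M₂ a v₂)) ?_ ?_ ?_ a
  · simp [← Odot.bilin_apply]
  · intro a b ha hb
    rw [map_add, add_lie, ha, hb]
    simp only [← Odot.bilin_apply, map_add, map_sub, LinearMap.add_apply, LinearMap.sub_apply]
    abel
  intro p a ha
  rw [Odot.lie_mk ha, zhuStarRight_eq ha, sub_sub_cancel, zeroMode_of_mem ha]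

variable (V M₁ M₂)

/-- The `ℂ`-linear map `A(M₁) ⊗_{A(V)} M₂(0) → M₁ ⊙ M₂`, `[v] ⊗ w ↦ v ⊙ w`. -/
noncomputable def zhuTensorToOdot : ZhuTensor V M₁ (Bottom V M₂) →ₗ[ℂ] Odot V M₁ M₂ :=
  (zhuTensorRel V M₁ (Bottom V M₂)).liftQ
    (TensorProduct.lift ((zhuO V M₁).liftQ
      ((Odot.bilin V M₁ M₂).compl₂ (AdmissibleModule.grade (V := V) (M := M₂) 0).subtype)
      fun x hx => LinearMap.mem_ker.2 (LinearMap.ext fun w => Odot.mk_zhuO_bottom hx w)))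
    (by
      refine Submodule.span_le.2 ?_
      rintro _ ⟨v, a, w, rfl⟩
      rw [SetLike.mem_coe, LinearMap.mem_ker, map_sub, sub_eq_zero]
      exact Odot.mk_zhuStarRight_bottom a v w)

variable {V M₁ M₂}

lemma zhuTensorToOdot_tmul (v : M₁) (w : Bottom V M₂) :
    zhuTensorToOdot V M₁ M₂ (ZhuTensor.tmul (ZhuBimodule.mk V v) w) = Odot.mk V v (w : M₂) := rfl

lemma zhuTensorToOdot_surjective (h : GeneratedByBottom V M₂) :
    Function.Surjective (zhuTensorToOdot V M₁ M₂) := by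
  rw [← LinearMap.range_eq_top, eq_top_iff, ← Odot.iSup_range_bottom_right h]
  refine iSup_le fun w => ?_
  rintro _ ⟨v, rfl⟩
  exact ⟨_, zhuTensorToOdot_tmul v w⟩

lemma zhuTensorToOdot_smul (x : BorcherdsLieZero V) (t : ZhuTensor V M₁ (Bottom V M₂)) :
    zhuTensorToOdot V M₁ M₂ (BorcherdsLieZero.toZhu x • t) = ⁅x, zhuTensorToOdot V M₁ M₂ t⁆ := by
  obtain ⟨a, rfl⟩ := BorcherdsLieZero.of_surjective x
  rw [BorcherdsLieZero.toZhu_of]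
  refine ZhuTensor.induction (P := fun t => zhuTensorToOdot V M₁ M₂ (ZhuAlgebra.mk a • t)
    = ⁅BorcherdsLieZero.of a, zhuTensorToOdot V M₁ M₂ t⁆) ?_ ?_ ?_ t
  · rw [smul_zero, map_zero, lie_zero]
  · intro s t hs ht
    rw [smul_add, map_add, map_add, lie_add, hs, ht]
  · intro y w
    obtain ⟨v, rfl⟩ := ZhuBimodule.mk_surjective y
    rw [ZhuTensor.smul_tmul, ZhuBimodule.smul_mk, zhuTensorToOdot_tmul, zhuTensorToOdot_tmul,
      Odot.lie_mk_bottom]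

lemma BorcherdsLieZero.toZhu_surjective :
    Function.Surjective (BorcherdsLieZero.toZhu : BorcherdsLieZero V → ZhuAlgebra V) := fun x => by
  obtain ⟨a, rfl⟩ := ZhuAlgebra.mk_surjective x
  exact ⟨_, BorcherdsLieZero.toZhu_of a⟩

/-- Composition with `A(M₁) ⊗_{A(V)} M₂(0) → M₁ ⊙ M₂`, as a map from `L(V)_0`-homomorphisms to
`A(V)`-homomorphisms. -/
noncomputable def odotHomToZhuTensorHom (V M₁ M₂ : Type*) [AddCommGroup V] [Module ℂ V] [VOA V]
    [AddCommGroup M₁] [Module ℂ M₁] [AdmissibleModule V M₁]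
    [AddCommGroup M₂] [Module ℂ M₂] [AdmissibleModule V M₂]
    (M₃ : Type*) [AddCommGroup M₃] [Module ℂ M₃] [AdmissibleModule V M₃] :
    (Odot V M₁ M₂ →ₗ⁅ℂ, BorcherdsLieZero V⁆ Bottom V M₃) →ₗ[ℂ]
      (ZhuTensor V M₁ (Bottom V M₂) →ₗ[ZhuAlgebra V] Bottom V M₃) where
  toFun f :=
    { toFun := fun t => f (zhuTensorToOdot V M₁ M₂ t)
      map_add' := fun s t => by rw [map_add, map_add]
      map_smul' := fun x t => by
        obtain ⟨x, rfl⟩ := BorcherdsLieZero.toZhu_surjective x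
        rw [zhuTensorToOdot_smul, LieModuleHom.map_lie, Bottom.lie_def, RingHom.id_apply] }
  map_add' _ _ := rfl
  map_smul' _ _ := rfl

lemma odotHomToZhuTensorHom_injective (h : GeneratedByBottom V M₂)
    (M₃ : Type*) [AddCommGroup M₃] [Module ℂ M₃] [AdmissibleModule V M₃] :
    Function.Injective (odotHomToZhuTensorHom V M₁ M₂ M₃) := fun f g hfg => by
  ext1 u
  obtain ⟨t, rfl⟩ := zhuTensorToOdot_surjective h u
  exact LinearMap.congr_fun hfg t

end Action

end VOATheory

theorem theoremA (V : Type*) [AddCommGroup V] [Module ℂ V] [VOATheory.VOA V]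
    (M₁ : Type*) [AddCommGroup M₁] [Module ℂ M₁] [VOATheory.AdmissibleModule V M₁]
    (M₂ : Type*) [AddCommGroup M₂] [Module ℂ M₂] [VOATheory.AdmissibleModule V M₂] :
    (VOATheory.GeneratedByBottom V M₁ ∨ VOATheory.GeneratedByBottom V M₂ →
      ∃ _ : Module (VOATheory.ZhuAlgebra V) (VOATheory.Odot V M₁ M₂),
        IsScalarTower ℂ (VOATheory.ZhuAlgebra V) (VOATheory.Odot V M₁ M₂) ∧
        (∀ (a : V) (v₁ : M₁) (v₂ : M₂),
          VOATheory.ZhuAlgebra.mk a • VOATheory.Odot.mk V v₁ v₂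
            = VOATheory.Odot.mk V
                (VOATheory.zhuStar V M₁ a v₁ - VOATheory.zhuStarRight V M₁ a v₁) v₂
              + VOATheory.Odot.mk V v₁ (VOATheory.zeroMode V M₂ a v₂)) ∧
        (∀ (x : VOATheory.BorcherdsLieZero V) (u : VOATheory.Odot V M₁ M₂),
          ⁅x, u⁆ = VOATheory.BorcherdsLieZero.toZhu x • u) ∧
        (VOATheory.GeneratedByBottom V M₂ →
          ∃ π : VOATheory.ZhuTensor V M₁ (VOATheory.Bottom V M₂) →ₗ[VOATheory.ZhuAlgebra V]
              VOATheory.Odot V M₁ M₂,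
            (∀ (v : M₁) (w : VOATheory.Bottom V M₂),
              π (VOATheory.ZhuTensor.tmul (VOATheory.ZhuBimodule.mk V v) w)
                = VOATheory.Odot.mk V v (w : M₂)) ∧
            Function.Surjective π)) ∧
    (VOATheory.GeneratedByBottom V M₂ →
      ∀ (M₃ : Type*) [AddCommGroup M₃] [Module ℂ M₃] [VOATheory.AdmissibleModule V M₃],
        Module.rank ℂ (VOATheory.Odot V M₁ M₂ →ₗ⁅ℂ, VOATheory.BorcherdsLieZero V⁆
            VOATheory.Bottom V M₃)
          ≤ Module.rank ℂ (VOATheory.ZhuTensor V M₁ (VOATheory.Bottom V M₂)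
              →ₗ[VOATheory.ZhuAlgebra V] VOATheory.Bottom V M₃)) := by
  refine ⟨fun h => ?_, fun h M₃ _ _ _ => LinearMap.rank_le_of_injective _
    (VOATheory.odotHomToZhuTensorHom_injective h M₃)⟩
  obtain ⟨inst, htower, hlie⟩ := VOATheory.Odot.exists_zhuAlgebra_module h
  refine ⟨inst, htower, fun a v₁ v₂ => ?_, hlie, fun h₂ =>
    ⟨{ VOATheory.zhuTensorToOdot V M₁ M₂ with map_smul' := fun x t => ?_ },
      VOATheory.zhuTensorToOdot_tmul, VOATheory.zhuTensorToOdot_surjective h₂⟩⟩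
  · rw [← VOATheory.BorcherdsLieZero.toZhu_of, ← hlie, VOATheory.Odot.lie_mk_eq_zhuStar_sub]
  · obtain ⟨x, rfl⟩ := VOATheory.BorcherdsLieZero.toZhu_surjective x
    exact (VOATheory.zhuTensorToOdot_smul x t).trans (hlie _ _)
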